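/- Let $N\ge 1$ and let $\Omega\subset\mathbb R^N$ be a bounded domain (non-empty, open, connected) with Lebesgue measure $|\Omega|$. Write $\omega_{N-1}$ for the surface measure of the unit sphere of $\mathbb R^N$ and $$c_N=\pi^{-N/2}\,\Gamma(\tfrac N2),\qquad \rho_N=2\ln 2+\psi(\tfrac N2)-\gamma,\qquad d_N=\frac{2\,\omega_{N-1}}{N^2(2\pi)^N},$$ where $\psi=\Gamma'/\Gamma$ and $\gamma$ is Euler's constant. Let $\mathbb H(\Omega)$ be the space of measurable $u:\mathbb R^N\to\mathbb R$ with $u\equiv 0$ in $\mathbb R^N\setminus\Omega$ and $\iint_{|x-y|\le 1}\frac{(u(x)-u(y))^2}{|x-y|^N}\,dx\,dy<\infty$, and for $u,w\in\mathbb H(\Omega)$ let $$\mathcal E_L(u,w)=\frac{c_N}2\iint_{|x-y|\le1}\frac{(u(x)-u(y))(w(x)-w(y))}{|x-y|^N}\,dx\,dy-c_N\iint_{|x-y|\ge1}\frac{u(x)w(y)}{|x-y|^N}\,dx\,dy+\rho_N\int_{\mathbb R^N}uw\,dx$$ be the quadratic form of the logarithmic Laplacian. A number $\lambda\in\mathbb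 R$ is a Dirichlet eigenvalue of the logarithmic Laplacian in $\Omega$ if there is $u\in\mathbb H(\Omega)$, not a.e. zero, with $\mathcal E_L(u,\phi)=\lambda\int_\Omega u\phi\,dx$ for all $\phi\in\mathbb H(\Omega)$. Let $$\lambda_1(\Omega)=\inf\Big\{\mathcal E_L(u,u)\;:\;u\in\mathbb H(\Omega),\ \int_\Omega u^2\,dx=1\Big\}$$ be the principal eigenvalue. Then this infimum is taken over a non-empty set that is bounded below, every Dirichlet eigenvalue $\lambda$ satisfies $\lambda\ge\lambda_1(\Omega)$, and: (i) $\lambda_1(\Omega)\ge -d_N|\Omega|$; (ii) if $|\Omega|<\dfrac{2}{eNd_N}$, then $\lambda_1(\Omega)>0$; (iii) if $|\Omega|\le\dfrac{2}{e^{e+1}Nd_N}$, then $$\lambda_1(\Omega)\ge\frac2N\left(\ln\Big(\frac{2}{eNd_N|\Omega|}\Big)-\ln\ln\Big(\frac{2}{eNd_N|\Omega|}\Big)\right).$$ -/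

import Mathlib

noncomputable section

open MeasureTheory Set

namespace LogLaplacian

/-- The surface measure `ω_{N-1}` of the unit sphere of `ℝ^N`; `Measure.toSphere` is the surface
measure on the sphere, normalized by integration in polar coordinates (`ω_0 = 2`, `ω_1 = 2π`,
`ω_2 = 4π`). -/
def sphereArea (N : ℕ) : ℝ :=
  (volume : Measure (EuclideanSpace ℝ (Fin N))).toSphere.real univ

/-- `c_N = π^{-N/2} Γ(N/2)`. -/
def cN (N : ℕ) : ℝ := Real.pi ^ (-((N : ℝ) / 2)) * Real.Gamma ((N : ℝ) / 2)

/-- `ρ_N = 2 ln 2 + ψ(N/2) - γ`, where `ψ = Γ'/Γ` is the digamma function. -/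
def rhoN (N : ℕ) : ℝ :=
  2 * Real.log 2 + logDeriv Real.Gamma ((N : ℝ) / 2) - Real.eulerMascheroniConstant

/-- `d_N = 2 ω_{N-1} / (N² (2π)^N)`. -/
def dN (N : ℕ) : ℝ := 2 * sphereArea N / ((N : ℝ) ^ 2 * (2 * Real.pi) ^ N)

/-- The pairs of points at distance at most one. -/
def near (N : ℕ) : Set (EuclideanSpace ℝ (Fin N) × EuclideanSpace ℝ (Fin N)) :=
  {p | dist p.1 p.2 ≤ 1}

/-- The pairs of points at distance at least one. -/
def far (N : ℕ) : Set (EuclideanSpace ℝ (Fin N) × EuclideanSpace ℝ (Fin N)) :=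
  {p | 1 ≤ dist p.1 p.2}

/-- The space `ℍ(Ω)`: (Lebesgue) measurable functions `u : ℝ^N → ℝ` vanishing outside `Ω` with
`∬_{|x-y| ≤ 1} (u(x) - u(y))² / |x-y|^N dx dy < ∞`. -/
def FormDomain {N : ℕ} (Ω : Set (EuclideanSpace ℝ (Fin N))) :
    Set (EuclideanSpace ℝ (Fin N) → ℝ) :=
  {u | AEMeasurable u volume ∧ (∀ x ∉ Ω, u x = 0) ∧
    IntegrableOn (fun p : EuclideanSpace ℝ (Fin N) × EuclideanSpace ℝ (Fin N) =>
      (u p.1 - u p.2) ^ 2 / dist p.1 p.2 ^ N) (near N)}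

/-- The inner product `𝓔(u,w)` of `ℍ(Ω)`. -/
def energy {N : ℕ} (u w : EuclideanSpace ℝ (Fin N) → ℝ) : ℝ :=
  cN N / 2 * ∫ p in near N, (u p.1 - u p.2) * (w p.1 - w p.2) / dist p.1 p.2 ^ N

/-- The quadratic form `𝓔_L(u,w)` of the logarithmic Laplacian. -/
def logForm {N : ℕ} (u w : EuclideanSpace ℝ (Fin N) → ℝ) : ℝ :=
  energy u w - cN N * (∫ p in far N, u p.1 * w p.2 / dist p.1 p.2 ^ N)
    + rhoN N * ∫ x, u x * w x

/-- `lam` is an eigenvalue of the Dirichlet problem `L_Δ u = lam u` in `Ω`, `u = 0` in `ℝ^N ∖ Ω`,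
in the weak sense. -/
def IsEigenvalue {N : ℕ} (Ω : Set (EuclideanSpace ℝ (Fin N))) (lam : ℝ) : Prop :=
  ∃ u ∈ FormDomain Ω, (¬ u =ᵐ[volume] 0) ∧
    ∀ φ ∈ FormDomain Ω, logForm u φ = lam * ∫ x in Ω, u x * φ x

/-- The values `𝓔_L(u,u)`, where `u ∈ ℍ(Ω)` and `‖u‖_{L²(Ω)} = 1`. -/
def rayleighValues {N : ℕ} (Ω : Set (EuclideanSpace ℝ (Fin N))) : Set ℝ :=
  {r | ∃ u ∈ FormDomain Ω, (∫ x in Ω, u x ^ 2) = 1 ∧ r = logForm u u}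

/-- The principal eigenvalue `λ_1(Ω)`, through its variational formula. -/
def principalEigenvalue {N : ℕ} (Ω : Set (EuclideanSpace ℝ (Fin N))) : ℝ :=
  sInf (rayleighValues Ω)

end LogLaplacian

end

/-! The form $\mathcal E_L$ is the Fourier multiplier $2\ln|\xi|$, and the bound is a bathtub
estimate. For normalized $u$ the spectral density has mass at most $1$ and, by Cauchy–Schwarz,
height at most $(2\pi)^{-N}|\Omega|$, so it cannot concentrate near $\xi=0$, where the logarithm is
very negative.

The unbounded multiplier is reached through the heat semigroup, with $s=1/(4t)$: $\mathcal
E_L(u,u)=\int_0^\infty (e^{-1/(4s)}-\langle u,e^{t\Delta}u\rangle)\,ds/s$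
(`logForm_heat_representation`). The kernel $c_N|z|^{-N}$ is the integral of the heat kernel against
$ds/s$. Cutting at $|x-y|=1$ leaves the heat mass of the unit ball, and $\rho_N$ is exactly the
integral of $e^{-1/(4s)}$ minus that mass (`integral_exp_sub_ballMass`).

For each $s$ the heat form is the integral of the spectral density against the decreasing weight
$e^{-|\xi|^2/(4s)}$, so the bathtub estimate applies with any radius $\tau$ (`heatForm_le_bathtub`).
Integration in $ds/s$ and Frullani's formula give $\mathcal E_L(u,u)\ge 2\ln\tau-d_N|\Omega|\tau^N$
(`le_logForm`). Taking $\tau=1$ yields (i). The optimal $\tau^N=2/(Nd_N|\Omega|)$ yields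
$\lambda_1\ge\frac2N\ln\frac{2}{eNd_N|\Omega|}$, hence (ii), and (iii) because the iterated
logarithm is nonnegative there.

A cone supported in a ball of $\Omega$ makes the set of Rayleigh values non-empty, and testing with
the eigenfunction itself shows that every eigenvalue belongs to it. -/

namespace LogLaplacian

open MeasureTheory Set
open scoped Pointwise RealInnerProductSpace

/-! ### Step functions and logarithms -/

/-- The difference of the step functions at `a` and at `1`, divided by the variable. -/
noncomputable def stepDiff (a s : ℝ) : ℝ :=
  ((Ici a).indicator 1 s - (Ici (1 : ℝ)).indicator 1 s) / s

lemma measurable_stepDiff : Measurable fun p : ℝ × ℝ => stepDiff p.1 p.2 := by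
  have h : (fun p : ℝ × ℝ => stepDiff p.1 p.2) = fun p : ℝ × ℝ =>
      ({q : ℝ × ℝ | q.1 ≤ q.2}.indicator 1 p - {q : ℝ × ℝ | 1 ≤ q.2}.indicator 1 p) / p.2 := by
    ext p
    simp [stepDiff, indicator]
  rw [h]
  exact ((measurable_one.indicator (measurableSet_le measurable_fst measurable_snd)).sub
    (measurable_one.indicator (measurableSet_le measurable_const measurable_snd))).div
    measurable_snd

lemma integrableOn_inv_Ico {a b : ℝ} (ha : 0 < a) : IntegrableOn (fun s : ℝ => s⁻¹) (Ico a b) := by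
  refine (ContinuousOn.integrableOn_Icc (a := a) (b := b) ?_).mono_set Ico_subset_Icc_self
  exact continuousOn_inv₀.mono fun x hx => (ha.trans_le hx.1).ne'

lemma setIntegral_inv_Ico {a b : ℝ} (ha : 0 < a) (hab : a ≤ b) :
    ∫ s in Ico a b, s⁻¹ = Real.log b - Real.log a := by
  rw [integral_Ico_eq_integral_Ioc, ← intervalIntegral.integral_of_le hab,
    integral_inv_of_pos ha (ha.trans_le hab), Real.log_div (ha.trans_le hab).ne' ha.ne']

lemma stepDiff_of_le_one {a : ℝ} (ha : a ≤ 1) :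
    stepDiff a = (Ico a 1).indicator fun s => s⁻¹ := by
  ext s
  simp only [stepDiff, indicator, mem_Ici, mem_Ico, Pi.one_apply]
  split_ifs <;> grind

lemma stepDiff_of_one_le {a : ℝ} (ha : 1 ≤ a) :
    stepDiff a = -(Ico 1 a).indicator fun s => s⁻¹ := by
  ext s
  simp only [stepDiff, indicator, mem_Ici, mem_Ico, Pi.one_apply, Pi.neg_apply]
  split_ifs <;> grind

lemma integrable_stepDiff {a : ℝ} (ha : 0 < a) :
    IntegrableOn (stepDiff a) (Ioi 0) := by
  rcases le_total a 1 with h | h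
  · rw [stepDiff_of_le_one h]
    exact ((integrable_indicator_iff measurableSet_Ico).2 (integrableOn_inv_Ico ha)).integrableOn
  · rw [stepDiff_of_one_le h]
    exact ((integrable_indicator_iff measurableSet_Ico).2
      (integrableOn_inv_Ico one_pos)).neg.integrableOn

lemma integral_stepDiff {a : ℝ} (ha : 0 < a) :
    ∫ s in Ioi 0, stepDiff a s = -Real.log a := by
  rcases le_total a 1 with h | h
  · rw [stepDiff_of_le_one h, setIntegral_indicator measurableSet_Ico,
      inter_eq_right.2 (show Ico a 1 ⊆ Ioi 0 from fun x hx => ha.trans_le hx.1),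
      setIntegral_inv_Ico ha h]
    simp
  · rw [stepDiff_of_one_le h]
    simp only [Pi.neg_apply]
    rw [integral_neg, setIntegral_indicator measurableSet_Ico,
      inter_eq_right.2 (show Ico 1 a ⊆ Ioi 0 from fun x hx => one_pos.trans_le hx.1),
      setIntegral_inv_Ico one_pos h]
    simp

lemma integral_abs_stepDiff {a : ℝ} (ha : 0 < a) :
    ∫ s in Ioi 0, |stepDiff a s| = |Real.log a| := by
  rcases le_total a 1 with h | h
  · rw [abs_of_nonpos (Real.log_nonpos ha.le h), ← integral_stepDiff ha]
    refine setIntegral_congr_fun measurableSet_Ioi fun s hs => abs_of_nonneg ?_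
    rw [stepDiff_of_le_one h]
    exact indicator_nonneg (fun x hx => inv_nonneg.2 (ha.le.trans hx.1)) _
  · rw [abs_of_nonneg (Real.log_nonneg h), ← neg_neg (Real.log a), ← integral_stepDiff ha,
      ← integral_neg]
    refine setIntegral_congr_fun measurableSet_Ioi fun s hs => abs_of_nonpos ?_
    rw [stepDiff_of_one_le h]
    exact neg_nonpos.2 (indicator_nonneg (fun x hx => inv_nonneg.2 (one_pos.le.trans hx.1)) _)

section Weighted

variable {X : Type*} [MeasurableSpace X] {μ : Measure X} {w a : X → ℝ}

/-- Tonelli: the integral of `|stepDiff a|` in $s$ is $|\log a|$, so integrability of $w\log a$ is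
what absolute integrability requires. -/
lemma integrable_mul_stepDiff (hw : AEStronglyMeasurable w μ) (ha : Measurable a)
    (hpos : ∀ᵐ x ∂μ, 0 < a x) (hlog : Integrable (fun x => w x * Real.log (a x)) μ) :
    Integrable (fun p : X × ℝ => w p.1 * stepDiff (a p.1) p.2)
      (μ.prod (volume.restrict (Ioi 0))) := by
  have hm : AEStronglyMeasurable (fun p : X × ℝ => w p.1 * stepDiff (a p.1) p.2)
      (μ.prod (volume.restrict (Ioi 0))) :=
    hw.comp_fst.mul (measurable_stepDiff.comp
      ((ha.comp measurable_fst).prodMk measurable_snd)).aestronglyMeasurable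
  refine (integrable_prod_iff hm).2 ⟨?_, ?_⟩
  · filter_upwards [hpos] with x hx using (integrable_stepDiff hx).const_mul _
  · refine hlog.norm.congr ?_
    filter_upwards [hpos] with x hx
    simp only [norm_mul, Real.norm_eq_abs]
    rw [integral_const_mul, integral_abs_stepDiff hx]

lemma integrableOn_integral_mul_stepDiff [SFinite μ] (hw : AEStronglyMeasurable w μ) (ha : Measurable a)
    (hpos : ∀ᵐ x ∂μ, 0 < a x) (hlog : Integrable (fun x => w x * Real.log (a x)) μ) :
    IntegrableOn (fun s => ∫ x, w x * stepDiff (a x) s ∂μ) (Ioi 0) :=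
  (integrable_mul_stepDiff hw ha hpos hlog).integral_prod_right

lemma integral_integral_mul_stepDiff [SFinite μ] (hw : AEStronglyMeasurable w μ) (ha : Measurable a)
    (hpos : ∀ᵐ x ∂μ, 0 < a x) (hlog : Integrable (fun x => w x * Real.log (a x)) μ) :
    ∫ s in Ioi 0, ∫ x, w x * stepDiff (a x) s ∂μ = -∫ x, w x * Real.log (a x) ∂μ := by
  rw [← integral_integral_swap (integrable_mul_stepDiff hw ha hpos hlog), ← integral_neg]
  refine integral_congr_ae ?_
  filter_upwards [hpos] with x hx
  rw [integral_const_mul, integral_stepDiff hx, mul_neg]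

/-- The weighted mean of the step differences, for a weight of total mass one. -/
lemma integral_mul_stepDiff_eq (hw : Integrable w μ) (ha : Measurable a) (s : ℝ)
    (hone : ∫ x, w x ∂μ = 1) :
    ∫ x, w x * stepDiff (a x) s ∂μ =
      ((∫ x in {x | a x ≤ s}, w x ∂μ) - (Ici (1 : ℝ)).indicator 1 s) / s := by
  have hset : MeasurableSet {x | a x ≤ s} := measurableSet_le ha measurable_const
  have h : ∀ x, w x * stepDiff (a x) s =
      ({x | a x ≤ s}.indicator w x - (Ici (1 : ℝ)).indicator 1 s * w x) / s := by
    intro x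
    simp only [stepDiff, indicator, mem_Ici, mem_ofPred_eq, Pi.one_apply]
    split_ifs <;> ring
  simp_rw [h]
  rw [integral_div, integral_sub (hw.indicator hset) (hw.const_mul _), integral_indicator hset,
    integral_const_mul, hone, mul_one]

end Weighted

/-! ### Derivative of the Gamma function -/

lemma integrableOn_rpow_mul_log_mul_exp {a : ℝ} (ha : 0 < a) :
    IntegrableOn (fun t => t ^ (a - 1) * (Real.log t * Real.exp (-t))) (Ioi 0) := by
  -- The decay exponents $0$ at the origin and $a+1$ at infinity strictly enclose $a$.
  have h := (mellin_hasDerivAt_of_isBigO_rpow (E := ℂ) (f := fun t => (Real.exp (-t) : ℂ))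
    (a := a + 1) (b := 0) (s := (a : ℂ)) ?_ ?_ (by simp) ?_ (by simpa using ha)).1
  · refine IntegrableOn.congr_fun (Integrable.re h) (fun t ht => ?_) measurableSet_Ioi
    have h1 : (t : ℂ) ^ ((a : ℂ) - 1) = ((t ^ (a - 1) : ℝ) : ℂ) := by
      rw [Complex.ofReal_cpow (le_of_lt ht)]
      simp
    simp only [h1, smul_eq_mul, Complex.real_smul, ← Complex.ofReal_mul, Complex.ofReal_re, RCLike.re_to_complex]
  · refine (Continuous.continuousOn ?_).locallyIntegrableOn measurableSet_Ioi
    exact Complex.continuous_ofReal.comp (Real.continuous_exp.comp continuous_neg)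
  · rw [← Asymptotics.isBigO_norm_left]
    simp_rw [Complex.norm_real, Asymptotics.isBigO_norm_left]
    simpa only [neg_one_mul] using (isLittleO_exp_neg_mul_rpow_atTop zero_lt_one _).isBigO
  · simp_rw [neg_zero, Real.rpow_zero]
    refine Asymptotics.isBigO_const_of_tendsto (?_ : Filter.Tendsto _ _ (nhds (1 : ℂ))) one_ne_zero
    rw [(by simp : (1 : ℂ) = Real.exp (-0))]
    exact (Complex.continuous_ofReal.comp
      (Real.continuous_exp.comp continuous_neg)).continuousWithinAt

lemma integral_rpow_mul_log_mul_exp {a : ℝ} (ha : 0 < a) :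
    ∫ t in Ioi 0, t ^ (a - 1) * (Real.log t * Real.exp (-t)) = deriv Real.Gamma a := by
  have h := Complex.hasDerivAt_GammaIntegral (s := (a : ℂ)) (by simpa using ha)
  have h2 : HasDerivAt Complex.Gamma
      (∫ t : ℝ in Ioi 0, (t : ℂ) ^ ((a : ℂ) - 1) * (Real.log t * Real.exp (-t))) a := by
    refine h.congr_of_eventuallyEq ?_
    have : {s : ℂ | 0 < s.re} ∈ nhds (a : ℂ) :=
      (isOpen_lt continuous_const Complex.continuous_re).mem_nhds (by simpa using ha)
    filter_upwards [this] with s hs using Complex.Gamma_eq_integral hs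
  have h3 : (∫ t : ℝ in Ioi 0, (t : ℂ) ^ ((a : ℂ) - 1) * (Real.log t * Real.exp (-t))) =
      ((∫ t in Ioi 0, t ^ (a - 1) * (Real.log t * Real.exp (-t)) : ℝ) : ℂ) := by
    rw [← integral_complex_ofReal]
    refine setIntegral_congr_fun measurableSet_Ioi fun t ht => ?_
    simp only [Complex.ofReal_mul]
    rw [Complex.ofReal_cpow (le_of_lt ht)]
    simp
  rw [h3] at h2
  have h4 := h2.real_of_complex
  simp only [Complex.ofReal_re] at h4
  exact (h4.congr_of_eventuallyEq (Filter.Eventually.of_forall fun x => by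
    simp [Complex.Gamma_ofReal])).deriv.symm

lemma deriv_Gamma_one : deriv Real.Gamma 1 = -Real.eulerMascheroniConstant := by
  rw [Real.eulerMascheroniConstant_eq_neg_deriv, neg_neg]

/-! ### Exponential weights and Frullani's formula -/

section Exp

variable {c : ℝ}

lemma integrableOn_exp_mul_log : IntegrableOn (fun t => Real.exp (-t) * Real.log t) (Ioi 0) := by
  refine (integrableOn_rpow_mul_log_mul_exp one_pos).congr_fun (fun t _ => ?_) measurableSet_Ioi
  simp [mul_comm]

lemma integral_exp_mul_log :
    ∫ t in Ioi 0, Real.exp (-t) * Real.log t = -Real.eulerMascheroniConstant := by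
  rw [← deriv_Gamma_one, ← integral_rpow_mul_log_mul_exp one_pos]
  refine setIntegral_congr_fun measurableSet_Ioi fun t _ => ?_
  simp [mul_comm]

lemma exp_mul_log_div_eq (hc : 0 < c) {t : ℝ} (ht : t ∈ Ioi (0 : ℝ)) :
    Real.exp (-t) * Real.log (c / t) =
      Real.log c * Real.exp (-t) - Real.exp (-t) * Real.log t := by
  rw [Real.log_div hc.ne' (ne_of_gt ht)]
  ring

lemma integrableOn_exp_neg : IntegrableOn (fun t : ℝ => Real.exp (-t)) (Ioi 0) :=
  integrableOn_exp_neg_Ioi 0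

lemma integrableOn_exp_mul_log_div (hc : 0 < c) :
    IntegrableOn (fun t => Real.exp (-t) * Real.log (c / t)) (Ioi 0) :=
  IntegrableOn.congr_fun ((integrableOn_exp_neg.const_mul _).sub integrableOn_exp_mul_log)
    (fun _ ht => (exp_mul_log_div_eq hc ht).symm) measurableSet_Ioi

/-- For an exponential variable $T$, $e^{-c/s}$ is the probability that $c/T\le s$. -/
lemma integral_exp_mul_stepDiff (hc : 0 < c) {s : ℝ} (hs : s ∈ Ioi (0 : ℝ)) :
    ∫ t in Ioi 0, Real.exp (-t) * stepDiff (c / t) s =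
      (Real.exp (-(c / s)) - (Ici (1 : ℝ)).indicator 1 s) / s := by
  have hs' : 0 < s := hs
  have hm : Measurable fun t : ℝ => c / t := measurable_const.div measurable_id
  rw [integral_mul_stepDiff_eq (w := fun t => Real.exp (-t)) integrableOn_exp_neg hm s
    ((integral_exp_neg_Ioi 0).trans (by simp)), Measure.restrict_restrict (measurableSet_le hm measurable_const)]
  have hset : {t | c / t ≤ s} ∩ Ioi 0 = Ici (c / s) := by
    ext t
    simp only [mem_inter_iff, mem_ofPred_eq, mem_Ioi, mem_Ici]
    constructor
    · rintro ⟨h1, h2⟩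
      rw [div_le_iff₀ h2] at h1
      rwa [div_le_iff₀ hs', mul_comm]
    · intro h
      have ht : 0 < t := (div_pos hc hs').trans_le h
      refine ⟨?_, ht⟩
      rw [div_le_iff₀ hs', mul_comm] at h
      rwa [div_le_iff₀ ht]
  rw [hset, integral_Ici_eq_integral_Ioi, integral_exp_neg_Ioi]

lemma integrableOn_exp_sub_step (hc : 0 < c) :
    IntegrableOn (fun s => (Real.exp (-(c / s)) - (Ici (1 : ℝ)).indicator 1 s) / s) (Ioi 0) := by
  refine (integrableOn_integral_mul_stepDiff (μ := volume.restrict (Ioi (0 : ℝ)))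
    (w := fun t => Real.exp (-t)) (a := fun t => c / t)
    integrableOn_exp_neg.aestronglyMeasurable (measurable_const.div measurable_id) ?_
    (integrableOn_exp_mul_log_div hc)).congr_fun (fun s hs => integral_exp_mul_stepDiff hc hs)
    measurableSet_Ioi
  filter_upwards [ae_restrict_mem measurableSet_Ioi] with t ht using div_pos hc ht

/-- The value is the mean of $-\log(c/T)$ for exponential $T$, and the mean of $\log T$ is
$\Gamma'(1)=-\gamma$. -/
lemma integral_exp_sub_step (hc : 0 < c) :
    ∫ s in Ioi 0, (Real.exp (-(c / s)) - (Ici (1 : ℝ)).indicator 1 s) / s =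
      -Real.log c - Real.eulerMascheroniConstant := by
  have hpos : ∀ᵐ t ∂volume.restrict (Ioi (0 : ℝ)), 0 < c / t := by
    filter_upwards [ae_restrict_mem measurableSet_Ioi] with t ht using div_pos hc ht
  have h := integral_integral_mul_stepDiff (μ := volume.restrict (Ioi (0 : ℝ)))
    (w := fun t => Real.exp (-t)) (a := fun t => c / t)
    integrableOn_exp_neg.aestronglyMeasurable (measurable_const.div measurable_id) hpos
    (integrableOn_exp_mul_log_div hc)
  rw [setIntegral_congr_fun measurableSet_Ioi fun s hs => integral_exp_mul_stepDiff hc hs,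
    setIntegral_congr_fun measurableSet_Ioi fun t ht => exp_mul_log_div_eq hc ht,
    integral_sub (integrableOn_exp_neg.const_mul _) integrableOn_exp_mul_log,
    integral_const_mul, integral_exp_mul_log, integral_exp_neg_Ioi] at h
  rw [h]
  simp
  ring

variable {b : ℝ}

lemma integrableOn_exp_sub_exp (hb : 0 < b) (hc : 0 < c) :
    IntegrableOn (fun s => (Real.exp (-(b / s)) - Real.exp (-(c / s))) / s) (Ioi 0) := by
  refine ((integrableOn_exp_sub_step hb).sub (integrableOn_exp_sub_step hc)).congr_fun
    (fun s _ => ?_) measurableSet_Ioi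
  simp only [Pi.sub_apply]
  ring

/-- A Frullani integral. -/
lemma integral_exp_sub_exp (hb : 0 < b) (hc : 0 < c) :
    ∫ s in Ioi 0, (Real.exp (-(b / s)) - Real.exp (-(c / s))) / s = Real.log (c / b) := by
  have h := integral_sub (integrableOn_exp_sub_step hb) (integrableOn_exp_sub_step hc)
  rw [integral_exp_sub_step hb, integral_exp_sub_step hc] at h
  simp only [← sub_div, sub_sub_sub_cancel_right] at h
  rw [h, Real.log_div hc.ne' hb.ne']
  ring

end Exp

/-! ### The heat kernel, its mass in the unit ball, and the constant $\rho_N$ -/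

section Gauss

/-- The heat kernel, as a function of the space variable and of `1 / (4t)`. -/
noncomputable def gaussKernel {N : ℕ} (s : ℝ) (z : EuclideanSpace ℝ (Fin N)) : ℝ :=
  (s / Real.pi) ^ ((N : ℝ) / 2) * Real.exp (-s * ‖z‖ ^ 2)

variable {N : ℕ} {s : ℝ}

lemma gaussKernel_nonneg (hs : 0 ≤ s) (z : EuclideanSpace ℝ (Fin N)) : 0 ≤ gaussKernel s z := by
  unfold gaussKernel; positivity

lemma gaussKernel_le (hs : 0 ≤ s) (z : EuclideanSpace ℝ (Fin N)) :
    gaussKernel s z ≤ (s / Real.pi) ^ ((N : ℝ) / 2) := by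
  unfold gaussKernel
  refine mul_le_of_le_one_right (by positivity) (Real.exp_le_one_iff.2 ?_)
  nlinarith [mul_nonneg hs (sq_nonneg ‖z‖)]

lemma gaussKernel_neg (z : EuclideanSpace ℝ (Fin N)) : gaussKernel s (-z) = gaussKernel s z := by
  simp [gaussKernel]

lemma measurable_gaussKernel :
    Measurable fun p : EuclideanSpace ℝ (Fin N) × ℝ => gaussKernel p.2 p.1 := by
  unfold gaussKernel
  fun_prop

lemma integral_gaussKernel (hs : 0 < s) :
    ∫ z : EuclideanSpace ℝ (Fin N), gaussKernel s z = 1 := by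
  unfold gaussKernel
  rw [integral_const_mul, GaussianFourier.integral_rexp_neg_mul_sq_norm hs,
    finrank_euclideanSpace_fin, ← Real.mul_rpow (by positivity) (by positivity),
    div_mul_div_cancel₀ (by positivity), div_self (by positivity), Real.one_rpow]

lemma integrable_gaussKernel (hs : 0 < s) :
    Integrable fun z : EuclideanSpace ℝ (Fin N) => gaussKernel s z :=
  -- The integral of a non-integrable function is $0$ by convention, so a nonzero value proves
  -- integrability.
  Integrable.of_integral_ne_zero (by rw [integral_gaussKernel hs]; exact one_ne_zero)

lemma nontrivial_of_one_le (hN : 1 ≤ N) : Nontrivial (EuclideanSpace ℝ (Fin N)) := by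
  have : Nonempty (Fin N) := ⟨⟨0, hN⟩⟩
  infer_instance

/-- The substitution $t=r^2$ matches the integrand of $\Gamma'(N/2)$ with the radial form of the
Gaussian mean of $\log|z|^2$. -/
lemma gauss_radial_eq (hN : 1 ≤ N) {r : ℝ} (hr : r ∈ Ioi (0 : ℝ)) :
    (2 * r ^ ((2 : ℝ) - 1)) • ((r ^ (2 : ℝ)) ^ ((N : ℝ) / 2 - 1) *
      (Real.log (r ^ (2 : ℝ)) * Real.exp (-(r ^ (2 : ℝ))))) =
    (2 * Real.pi ^ ((N : ℝ) / 2)) * (r ^ (N - 1) •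
      ((1 / Real.pi) ^ ((N : ℝ) / 2) * Real.exp (-1 * r ^ 2) * Real.log (r ^ 2))) := by
  have hr' : 0 < r := hr
  have h1 : r ^ ((2 : ℝ) - 1) * (r ^ (2 : ℝ)) ^ ((N : ℝ) / 2 - 1) = r ^ (N - 1) := by
    rw [← Real.rpow_mul hr'.le, ← Real.rpow_add hr', ← Real.rpow_natCast, Nat.cast_sub hN]
    congr 1
    push_cast
    ring
  have h2 : Real.pi ^ ((N : ℝ) / 2) * (1 / Real.pi) ^ ((N : ℝ) / 2) = 1 := by
    rw [← Real.mul_rpow (by positivity) (by positivity), mul_one_div_cancel (by positivity),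
      Real.one_rpow]
  rw [← h1]
  simp only [smul_eq_mul, Real.rpow_two, neg_one_mul]
  linear_combination (-2 * r ^ ((2 : ℝ) - 1) * (r ^ 2) ^ ((N : ℝ) / 2 - 1) * Real.log (r ^ 2)
    * Real.exp (-r ^ 2)) * h2

lemma integrable_gaussKernel_mul_log (hN : 1 ≤ N) :
    Integrable fun z : EuclideanSpace ℝ (Fin N) => gaussKernel 1 z * Real.log (‖z‖ ^ 2) := by
  have := nontrivial_of_one_le hN
  have h := integrable_fun_norm_addHaar (E := EuclideanSpace ℝ (Fin N)) volume (f := fun r =>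
    (1 / Real.pi) ^ ((N : ℝ) / 2) * Real.exp (-1 * r ^ 2) * Real.log (r ^ 2))
  refine h.2 ?_
  rw [finrank_euclideanSpace_fin]
  have h1 := (integrableOn_Ioi_comp_rpow_iff
    (fun t : ℝ => t ^ ((N : ℝ) / 2 - 1) * (Real.log t * Real.exp (-t))) (p := 2) (by norm_num)).2
    (integrableOn_rpow_mul_log_mul_exp (by positivity))
  rw [abs_of_pos (by norm_num : (0 : ℝ) < 2),
    integrableOn_congr_fun (fun r hr => gauss_radial_eq hN hr) measurableSet_Ioi] at h1
  exact (integrable_const_mul_iff (by simp; positivity) _).1 h1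

lemma volume_real_ball (hN : 1 ≤ N) :
    volume.real (Metric.ball (0 : EuclideanSpace ℝ (Fin N)) 1) =
      Real.pi ^ ((N : ℝ) / 2) / Real.Gamma ((N : ℝ) / 2 + 1) := by
  have : Nonempty (Fin N) := ⟨⟨0, hN⟩⟩
  rw [Measure.real, EuclideanSpace.volume_ball]
  simp only [ENNReal.ofReal_one, one_pow, one_mul, Fintype.card_fin]
  have : 0 < Real.Gamma ((N : ℝ) / 2 + 1) := Real.Gamma_pos_of_pos (by positivity)
  rw [ENNReal.toReal_ofReal (by positivity), Real.sqrt_eq_rpow, ← Real.rpow_natCast,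
    ← Real.rpow_mul Real.pi_pos.le]
  congr 2
  ring

lemma integral_gaussKernel_mul_log (hN : 1 ≤ N) :
    ∫ z : EuclideanSpace ℝ (Fin N), gaussKernel 1 z * Real.log (‖z‖ ^ 2) =
      logDeriv Real.Gamma ((N : ℝ) / 2) := by
  have := nontrivial_of_one_le hN
  have hN0 : (0 : ℝ) < (N : ℝ) / 2 := by positivity
  have h := integral_fun_norm_addHaar (E := EuclideanSpace ℝ (Fin N)) volume (fun r =>
    (1 / Real.pi) ^ ((N : ℝ) / 2) * Real.exp (-1 * r ^ 2) * Real.log (r ^ 2))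
  rw [finrank_euclideanSpace_fin, volume_real_ball hN] at h
  unfold gaussKernel
  rw [h]
  have h1 := integral_comp_rpow_Ioi_of_pos
    (g := fun t : ℝ => t ^ ((N : ℝ) / 2 - 1) * (Real.log t * Real.exp (-t))) (p := 2) (by norm_num)
  rw [setIntegral_congr_fun measurableSet_Ioi (fun r hr => gauss_radial_eq hN hr),
    integral_rpow_mul_log_mul_exp hN0, integral_const_mul] at h1
  have hG : Real.Gamma ((N : ℝ) / 2) ≠ 0 := (Real.Gamma_pos_of_pos hN0).ne'
  rw [logDeriv_apply, ← h1, Real.Gamma_add_one hN0.ne']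
  simp only [nsmul_eq_mul]
  generalize (∫ r in Ioi (0 : ℝ), r ^ (N - 1) • ((1 / Real.pi) ^ ((N : ℝ) / 2) *
    Real.exp (-1 * r ^ 2) * Real.log (r ^ 2))) = I
  rw [smul_eq_mul]
  field_simp

/-- Dilation by $\sqrt s$. It exhibits the heat mass of the unit ball as the distribution function
of $|z|^2$ under the fixed Gaussian `gaussKernel 1`. -/
lemma setIntegral_gaussKernel_eq (hs : 0 < s) :
    ∫ z : EuclideanSpace ℝ (Fin N) in {z | ‖z‖ ^ 2 ≤ s}, gaussKernel 1 z =
      ∫ z : EuclideanSpace ℝ (Fin N) in Metric.closedBall 0 1, gaussKernel s z := by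
  have hq : 0 < √s := Real.sqrt_pos.2 hs
  have h := Measure.setIntegral_comp_smul_of_pos (volume : Measure (EuclideanSpace ℝ (Fin N)))
    (fun z => gaussKernel 1 z) (Metric.closedBall 0 1) hq
  have hset : √s • Metric.closedBall (0 : EuclideanSpace ℝ (Fin N)) 1 = {z | ‖z‖ ^ 2 ≤ s} := by
    rw [smul_closedBall _ _ zero_le_one]
    ext z
    simp [Real.le_sqrt (norm_nonneg z) hs.le, abs_of_pos hq]
  rw [hset, finrank_euclideanSpace_fin] at h
  have h2 : ∀ z : EuclideanSpace ℝ (Fin N), gaussKernel s z = √s ^ N * gaussKernel 1 (√s • z) := by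
    intro z
    simp only [gaussKernel, norm_smul, Real.norm_eq_abs, mul_pow, sq_abs, Real.sq_sqrt hs.le]
    have hsN : √s ^ N = s ^ ((N : ℝ) / 2) := by
      rw [Real.sqrt_eq_rpow, ← Real.rpow_natCast, ← Real.rpow_mul hs.le, one_div_mul_eq_div]
    rw [div_eq_mul_one_div s, Real.mul_rpow hs.le (by positivity), hsN]
    ring_nf
  simp_rw [h2]
  rw [integral_const_mul, h, smul_eq_mul, mul_inv_cancel_left₀ (by positivity)]

/-- The mass of the heat kernel in the unit ball. -/
noncomputable def ballMass (N : ℕ) (s : ℝ) : ℝ :=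
  ∫ z : EuclideanSpace ℝ (Fin N) in Metric.closedBall 0 1, gaussKernel s z

lemma integral_gauss_mul_stepDiff (hs : s ∈ Ioi (0 : ℝ)) :
    ∫ z : EuclideanSpace ℝ (Fin N), gaussKernel 1 z * stepDiff (‖z‖ ^ 2) s =
      (ballMass N s - (Ici (1 : ℝ)).indicator 1 s) / s := by
  rw [integral_mul_stepDiff_eq (integrable_gaussKernel one_pos) (by fun_prop) s
    (integral_gaussKernel one_pos), setIntegral_gaussKernel_eq hs, ballMass]

lemma integrableOn_ballMass_sub_step (hN : 1 ≤ N) :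
    IntegrableOn (fun s => (ballMass N s - (Ici (1 : ℝ)).indicator 1 s) / s) (Ioi 0) := by
  have := nontrivial_of_one_le hN
  refine (integrableOn_integral_mul_stepDiff (integrable_gaussKernel one_pos).aestronglyMeasurable
    (by fun_prop) ?_ (integrable_gaussKernel_mul_log hN)).congr_fun
    (fun s hs => integral_gauss_mul_stepDiff hs) measurableSet_Ioi
  filter_upwards [Measure.ae_ne volume 0] with z hz
  exact pow_pos (norm_pos_iff.2 hz) 2

lemma integral_ballMass_sub_step (hN : 1 ≤ N) :
    ∫ s in Ioi 0, (ballMass N s - (Ici (1 : ℝ)).indicator 1 s) / s =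
      -logDeriv Real.Gamma ((N : ℝ) / 2) := by
  have := nontrivial_of_one_le hN
  rw [← integral_gaussKernel_mul_log hN, ← integral_integral_mul_stepDiff
    (integrable_gaussKernel one_pos).aestronglyMeasurable (by fun_prop) _
    (integrable_gaussKernel_mul_log hN)]
  · exact setIntegral_congr_fun measurableSet_Ioi fun s hs => (integral_gauss_mul_stepDiff hs).symm
  · filter_upwards [Measure.ae_ne volume 0] with z hz
    exact pow_pos (norm_pos_iff.2 hz) 2

lemma integrableOn_exp_sub_ballMass (hN : 1 ≤ N) {c : ℝ} (hc : 0 < c) :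
    IntegrableOn (fun s => (Real.exp (-(c / s)) - ballMass N s) / s) (Ioi 0) := by
  refine ((integrableOn_exp_sub_step hc).sub (integrableOn_ballMass_sub_step hN)).congr_fun
    (fun s _ => ?_) measurableSet_Ioi
  simp only [Pi.sub_apply]
  ring

/-- Both terms tend to $1$ as $s\to\infty$, so each is compared with the step at $1$, which cancels
in the difference. The two values are $2\ln2-\gamma$ and $-\psi(N/2)$. -/
lemma integral_exp_sub_ballMass (hN : 1 ≤ N) :
    ∫ s in Ioi 0, (Real.exp (-(1 / 4 / s)) - ballMass N s) / s = rhoN N := by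
  have hc : (0 : ℝ) < 1 / 4 := by norm_num
  have h := integral_sub (integrableOn_exp_sub_step hc) (integrableOn_ballMass_sub_step hN)
  rw [integral_exp_sub_step hc, integral_ballMass_sub_step hN] at h
  have h4 : Real.log (1 / 4) = -(2 * Real.log 2) := by
    rw [show (1 / 4 : ℝ) = (2 ^ 2)⁻¹ by norm_num, Real.log_inv, Real.log_pow]
    norm_num
  rw [rhoN]
  rw [h4] at h
  simp only [← sub_div, sub_sub_sub_cancel_right] at h
  rw [h]
  ring

/-- Subordination of the kernel of the logarithmic Laplacian to the heat kernel. -/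
lemma integral_gaussKernel_div (hN : 1 ≤ N) {z : EuclideanSpace ℝ (Fin N)} (hz : z ≠ 0) :
    ∫ s in Ioi 0, gaussKernel s z / s = cN N / ‖z‖ ^ N := by
  have hz' : 0 < ‖z‖ := norm_pos_iff.2 hz
  have hN0 : (0 : ℝ) < (N : ℝ) / 2 := by positivity
  have h := Real.integral_rpow_mul_exp_neg_mul_Ioi hN0 (pow_pos hz' 2)
  have h1 : ∀ s ∈ Ioi (0 : ℝ), gaussKernel s z / s = Real.pi ^ (-((N : ℝ) / 2)) *
      (s ^ ((N : ℝ) / 2 - 1) * Real.exp (-(‖z‖ ^ 2 * s))) := by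
    intro s hs
    have hs' : 0 < s := hs
    rw [gaussKernel, Real.div_rpow hs'.le Real.pi_pos.le, Real.rpow_neg Real.pi_pos.le,
      Real.rpow_sub hs', Real.rpow_one, show -s * ‖z‖ ^ 2 = -(‖z‖ ^ 2 * s) by ring]
    field_simp
  rw [setIntegral_congr_fun measurableSet_Ioi h1, integral_const_mul, h, cN,
    Real.div_rpow zero_le_one (by positivity), Real.one_rpow, ← Real.rpow_natCast ‖z‖ 2,
    ← Real.rpow_mul hz'.le, show ((2 : ℕ) : ℝ) * ((N : ℝ) / 2) = N by push_cast; ring,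
    Real.rpow_natCast]
  ring

lemma cN_pos (hN : 1 ≤ N) : 0 < cN N := by
  have : 0 < Real.Gamma ((N : ℝ) / 2) := Real.Gamma_pos_of_pos (by positivity)
  unfold cN
  positivity

lemma integrableOn_gaussKernel_div (hN : 1 ≤ N) {z : EuclideanSpace ℝ (Fin N)} (hz : z ≠ 0) :
    IntegrableOn (fun s => gaussKernel s z / s) (Ioi 0) := by
  refine Integrable.of_integral_ne_zero ?_
  rw [integral_gaussKernel_div hN hz]
  have := cN_pos hN
  have := norm_pos_iff.2 hz
  positivity

end Gauss

/-! ### Heat representation of the form in physical space -/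

section Space

variable {N : ℕ} {u k : EuclideanSpace ℝ (Fin N) → ℝ} {s : ℝ}

lemma measurableSet_near : MeasurableSet (near N) :=
  (isClosed_le continuous_dist continuous_const).measurableSet

lemma measurableSet_far : MeasurableSet (far N) :=
  (isClosed_le continuous_const continuous_dist).measurableSet

/-- The overlap $|x-y|=1$ is null, since each of its slices is a sphere. -/
lemma far_ae_eq_compl_near (hN : 1 ≤ N) : far N =ᵐ[volume] ((near N)ᶜ : Set _) := by
  have := nontrivial_of_one_le hN
  have hm : MeasurableSet {p : EuclideanSpace ℝ (Fin N) × EuclideanSpace ℝ (Fin N) |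
      dist p.1 p.2 = 1} := (isClosed_eq continuous_dist continuous_const).measurableSet
  have h0 : (volume : Measure (EuclideanSpace ℝ (Fin N) × EuclideanSpace ℝ (Fin N)))
      {p | dist p.1 p.2 = 1} = 0 := by
    rw [Measure.volume_eq_prod, Measure.measure_prod_null hm]
    refine Filter.Eventually.of_forall fun x => ?_
    have : Prod.mk x ⁻¹' {p : EuclideanSpace ℝ (Fin N) × EuclideanSpace ℝ (Fin N) |
        dist p.1 p.2 = 1} = Metric.sphere x 1 := by
      ext y
      rw [mem_preimage, mem_ofPred_eq, Metric.mem_sphere, dist_comm]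
    change volume (Prod.mk x ⁻¹' _) = 0
    rw [this]
    exact Measure.addHaar_sphere _ _ _
  have h1 : ∀ᵐ p ∂(volume : Measure (EuclideanSpace ℝ (Fin N) × EuclideanSpace ℝ (Fin N))),
      dist p.1 p.2 ≠ 1 := by
    rw [ae_iff]
    simpa using h0
  filter_upwards [h1] with p hp
  refine propext ⟨fun h h' => hp (le_antisymm h' h), fun h => ?_⟩
  exact (not_le.1 (show ¬ dist p.1 p.2 ≤ 1 from h)).le

/-- A function of the first variable times an even function of the difference. -/
lemma integrable_fst_mul_sub {f : EuclideanSpace ℝ (Fin N) → ℝ} (hf : Integrable f)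
    (hk : Integrable k) (heven : ∀ z, k (-z) = k z) :
    Integrable fun p : EuclideanSpace ℝ (Fin N) × EuclideanSpace ℝ (Fin N) =>
      f p.1 * k (p.1 - p.2) := by
  have h := (Integrable.convolution_integrand (ContinuousLinearMap.mul ℝ ℝ) hf hk).swap
  refine h.congr (Filter.Eventually.of_forall fun p => ?_)
  simp only [Function.comp, Prod.swap, ContinuousLinearMap.mul_apply']
  rw [← heven, neg_sub]

lemma integrable_snd_mul_sub {f : EuclideanSpace ℝ (Fin N) → ℝ} (hf : Integrable f)
    (hk : Integrable k) :
    Integrable fun p : EuclideanSpace ℝ (Fin N) × EuclideanSpace ℝ (Fin N) =>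
      f p.2 * k (p.1 - p.2) :=
  Integrable.convolution_integrand (ContinuousLinearMap.mul ℝ ℝ) hf hk

lemma integral_snd_mul_sub {f : EuclideanSpace ℝ (Fin N) → ℝ} (hf : Integrable f)
    (hk : Integrable k) :
    ∫ p : EuclideanSpace ℝ (Fin N) × EuclideanSpace ℝ (Fin N), f p.2 * k (p.1 - p.2) =
      (∫ x, f x) * ∫ z, k z := by
  rw [Measure.volume_eq_prod, integral_prod _ (integrable_snd_mul_sub hf hk)]
  exact integral_convolution (ContinuousLinearMap.mul ℝ ℝ) hf hk

lemma integral_fst_mul_sub {f : EuclideanSpace ℝ (Fin N) → ℝ} (hf : Integrable f)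
    (hk : Integrable k) (heven : ∀ z, k (-z) = k z) :
    ∫ p : EuclideanSpace ℝ (Fin N) × EuclideanSpace ℝ (Fin N), f p.1 * k (p.1 - p.2) =
      (∫ x, f x) * ∫ z, k z := by
  rw [← integral_snd_mul_sub hf hk, Measure.volume_eq_prod, ← integral_prod_swap]
  refine integral_congr_ae (Filter.Eventually.of_forall fun p => ?_)
  simp only [Prod.fst_swap, Prod.snd_swap]
  rw [← heven, neg_sub]

lemma integrable_mul_mul_sub (hu : Integrable u) (hk : Integrable k) {C : ℝ}
    (hC : ∀ z, |k z| ≤ C) :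
    Integrable fun p : EuclideanSpace ℝ (Fin N) × EuclideanSpace ℝ (Fin N) =>
      u p.1 * u p.2 * k (p.1 - p.2) := by
  refine (hu.mul_prod hu).mul_bdd ?_ (Filter.Eventually.of_forall fun p => hC _)
  exact hk.aestronglyMeasurable.comp_quasiMeasurePreserving
    (quasiMeasurePreserving_sub_of_right_invariant volume volume)

lemma sub_sq_mul_eq (p : EuclideanSpace ℝ (Fin N) × EuclideanSpace ℝ (Fin N)) :
    (u p.1 - u p.2) ^ 2 * k (p.1 - p.2) =
      u p.1 ^ 2 * k (p.1 - p.2) + u p.2 ^ 2 * k (p.1 - p.2) -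
        2 * (u p.1 * u p.2 * k (p.1 - p.2)) := by
  ring

lemma integral_sub_sq_mul (hu : Integrable u) (hu2 : Integrable fun x => u x ^ 2)
    (hk : Integrable k) {C : ℝ} (hC : ∀ z, |k z| ≤ C) (heven : ∀ z, k (-z) = k z) :
    ∫ p : EuclideanSpace ℝ (Fin N) × EuclideanSpace ℝ (Fin N),
      (u p.1 - u p.2) ^ 2 * k (p.1 - p.2) =
    2 * ((∫ x, u x ^ 2) * ∫ z, k z) -
      2 * ∫ p : EuclideanSpace ℝ (Fin N) × EuclideanSpace ℝ (Fin N),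
        u p.1 * u p.2 * k (p.1 - p.2) := by
  have h1 := integrable_fst_mul_sub hu2 hk heven
  have h2 := integrable_snd_mul_sub hu2 hk
  have h3 := integral_sub (h1.add h2) ((integrable_mul_mul_sub hu hk hC).const_mul 2)
  simp only [Pi.add_apply] at h3
  simp_rw [sub_sq_mul_eq]
  rw [h3, integral_add h1 h2, integral_const_mul, integral_fst_mul_sub hu2 hk heven,
    integral_snd_mul_sub hu2 hk]
  ring

lemma abs_gaussKernel_le (hs : 0 < s) (z : EuclideanSpace ℝ (Fin N)) :
    |gaussKernel s z| ≤ (s / Real.pi) ^ ((N : ℝ) / 2) := by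
  rw [abs_of_nonneg (gaussKernel_nonneg hs.le z)]
  exact gaussKernel_le hs.le z

/-- The quadratic form of the heat semigroup. -/
noncomputable def heatForm (u : EuclideanSpace ℝ (Fin N) → ℝ) (s : ℝ) : ℝ :=
  ∫ p : EuclideanSpace ℝ (Fin N) × EuclideanSpace ℝ (Fin N),
    u p.1 * u p.2 * gaussKernel s (p.1 - p.2)

lemma heatForm_le (hu : Integrable u) (hu2 : Integrable fun x => u x ^ 2) (hs : 0 < s) :
    heatForm u s ≤ ∫ x, u x ^ 2 := by
  have h := integral_sub_sq_mul hu hu2 (integrable_gaussKernel hs) (abs_gaussKernel_le hs)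
    gaussKernel_neg
  have h0 : 0 ≤ ∫ p : EuclideanSpace ℝ (Fin N) × EuclideanSpace ℝ (Fin N),
      (u p.1 - u p.2) ^ 2 * gaussKernel s (p.1 - p.2) :=
    integral_nonneg fun p => mul_nonneg (sq_nonneg _) (gaussKernel_nonneg hs.le _)
  rw [integral_gaussKernel hs, mul_one] at h
  unfold heatForm
  linarith

/-- Expanding the square against the kernel cut off to the unit ball gives mass times $\|u\|_2^2$,
minus the near part of the cross term. The near and far cross terms together form `heatForm`. -/
lemma near_far_heat_identity (hN : 1 ≤ N) (hu : Integrable u)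
    (hu2 : Integrable fun x => u x ^ 2) (hs : 0 < s) :
    (1 / 2) * (∫ p in near N, (u p.1 - u p.2) ^ 2 * gaussKernel s (p.1 - p.2)) -
      ∫ p in far N, u p.1 * u p.2 * gaussKernel s (p.1 - p.2) =
    ballMass N s * (∫ x, u x ^ 2) - heatForm u s := by
  set k : EuclideanSpace ℝ (Fin N) → ℝ :=
    (Metric.closedBall 0 1).indicator fun z => gaussKernel s z with hk
  have hki : Integrable k := (integrable_gaussKernel hs).indicator measurableSet_closedBall
  have hkint : ∫ z, k z = ballMass N s := integral_indicator measurableSet_closedBall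
  have hkC : ∀ z, |k z| ≤ (s / Real.pi) ^ ((N : ℝ) / 2) := fun z => by
    rw [hk, indicator]
    split_ifs
    · exact abs_gaussKernel_le hs z
    · rw [abs_zero]; positivity
  have hkeven : ∀ z, k (-z) = k z := fun z => by
    simp [hk, indicator, gaussKernel_neg]
  have hkmul : ∀ F : EuclideanSpace ℝ (Fin N) × EuclideanSpace ℝ (Fin N) → ℝ,
      ∫ p in near N, F p * gaussKernel s (p.1 - p.2) = ∫ p, F p * k (p.1 - p.2) := by
    intro F
    rw [← integral_indicator measurableSet_near]
    congr 1
    ext p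
    simp [hk, indicator, near, dist_eq_norm]
  have h1 := integral_sub_sq_mul hu hu2 hki hkC hkeven
  have h2 := integral_add_compl (measurableSet_near (N := N))
    (integrable_mul_mul_sub hu (integrable_gaussKernel hs) (abs_gaussKernel_le hs))
  rw [setIntegral_congr_set (far_ae_eq_compl_near hN), hkmul, h1, hkint, heatForm, ← h2,
    hkmul fun p => u p.1 * u p.2]
  ring

section Subordination

variable {ν : Measure (EuclideanSpace ℝ (Fin N) × EuclideanSpace ℝ (Fin N))}
  {F : EuclideanSpace ℝ (Fin N) × EuclideanSpace ℝ (Fin N) → ℝ}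

/-- Tonelli, with the $s$-integral done first. On the diagonal that integral diverges, which is why
$F$ must vanish there. -/
lemma integrable_mul_gaussKernel_div (hN : 1 ≤ N) (hFm : AEStronglyMeasurable F ν)
    (hdiag : ∀ᵐ p ∂ν, p.1 = p.2 → F p = 0)
    (hF : Integrable (fun p => F p / dist p.1 p.2 ^ N) ν) :
    Integrable (fun q : (EuclideanSpace ℝ (Fin N) × EuclideanSpace ℝ (Fin N)) × ℝ =>
      F q.1 * (gaussKernel q.2 (q.1.1 - q.1.2) / q.2)) (ν.prod (volume.restrict (Ioi 0))) := by
  have hm : AEStronglyMeasurable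
      (fun q : (EuclideanSpace ℝ (Fin N) × EuclideanSpace ℝ (Fin N)) × ℝ =>
        F q.1 * (gaussKernel q.2 (q.1.1 - q.1.2) / q.2)) (ν.prod (volume.restrict (Ioi 0))) := by
    refine hFm.comp_fst.mul (Measurable.aestronglyMeasurable ?_)
    refine (measurable_gaussKernel.comp (?_ : Measurable fun q :
      (EuclideanSpace ℝ (Fin N) × EuclideanSpace ℝ (Fin N)) × ℝ => (q.1.1 - q.1.2, q.2))).div
      measurable_snd
    fun_prop
  refine (integrable_prod_iff hm).2 ⟨?_, ?_⟩
  · filter_upwards [hdiag] with p hp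
    by_cases h : p.1 = p.2
    · simp [hp h]
    · exact (integrableOn_gaussKernel_div hN (sub_ne_zero.2 h)).const_mul _
  · refine (hF.norm.const_mul (cN N)).congr ?_
    filter_upwards [hdiag] with p hp
    by_cases h : p.1 = p.2
    · simp [hp h]
    · simp only [norm_mul, Real.norm_eq_abs]
      rw [integral_const_mul, setIntegral_congr_fun (g := fun s => gaussKernel s (p.1 - p.2) / s)
        measurableSet_Ioi, integral_gaussKernel_div hN (sub_ne_zero.2 h), abs_div,
        abs_of_nonneg (pow_nonneg dist_nonneg N), dist_eq_norm]
      · ring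
      · intro s hs
        exact abs_of_nonneg (div_nonneg (gaussKernel_nonneg (le_of_lt hs) _) (le_of_lt hs))

lemma integral_mul_gaussKernel_div_eq (s : ℝ) :
    ∫ p, F p * (gaussKernel s (p.1 - p.2) / s) ∂ν =
      (∫ p, F p * gaussKernel s (p.1 - p.2) ∂ν) / s := by
  simp_rw [← mul_div_assoc]
  exact integral_div _ _

lemma integrableOn_subordination [SFinite ν] (hN : 1 ≤ N) (hFm : AEStronglyMeasurable F ν)
    (hdiag : ∀ᵐ p ∂ν, p.1 = p.2 → F p = 0)
    (hF : Integrable (fun p => F p / dist p.1 p.2 ^ N) ν) :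
    IntegrableOn (fun s => (∫ p, F p * gaussKernel s (p.1 - p.2) ∂ν) / s) (Ioi 0) := by
  have h := (integrable_mul_gaussKernel_div hN hFm hdiag hF).integral_prod_right
  simp only [integral_mul_gaussKernel_div_eq] at h
  exact h

lemma integral_subordination [SFinite ν] (hN : 1 ≤ N) (hFm : AEStronglyMeasurable F ν)
    (hdiag : ∀ᵐ p ∂ν, p.1 = p.2 → F p = 0)
    (hF : Integrable (fun p => F p / dist p.1 p.2 ^ N) ν) :
    ∫ s in Ioi 0, (∫ p, F p * gaussKernel s (p.1 - p.2) ∂ν) / s =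
      cN N * ∫ p, F p / dist p.1 p.2 ^ N ∂ν := by
  simp_rw [← integral_mul_gaussKernel_div_eq]
  rw [← integral_integral_swap (integrable_mul_gaussKernel_div hN hFm hdiag hF),
    ← integral_const_mul]
  refine integral_congr_ae ?_
  filter_upwards [hdiag] with p hp
  rw [integral_const_mul]
  by_cases h : p.1 = p.2
  · simp [hp h]
  · rw [integral_gaussKernel_div hN (sub_ne_zero.2 h), dist_eq_norm]
    ring

end Subordination

lemma integrableOn_far_mul (hu : Integrable u) :
    IntegrableOn (fun p : EuclideanSpace ℝ (Fin N) × EuclideanSpace ℝ (Fin N) =>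
      u p.1 * u p.2 / dist p.1 p.2 ^ N) (far N) := by
  have h : IntegrableOn (fun p : EuclideanSpace ℝ (Fin N) × EuclideanSpace ℝ (Fin N) =>
      u p.1 * u p.2) (far N) := (hu.mul_prod hu).integrableOn
  simp_rw [div_eq_mul_inv]
  refine Integrable.mul_bdd (c := 1) h ?_ ?_
  · exact (measurable_dist.pow_const N).inv.aestronglyMeasurable
  · filter_upwards [ae_restrict_mem measurableSet_far] with p hp
    rw [norm_inv, norm_pow, Real.norm_of_nonneg dist_nonneg]
    exact inv_le_one_of_one_le₀ (one_le_pow₀ hp)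

/-- The near term, the far term and the $\rho_N$ term are each written as an integral in $ds/s$. For
$\|u\|_2=1$ the ball masses cancel. -/
lemma logForm_heat_representation (hN : 1 ≤ N) (hu : Integrable u)
    (hu2 : Integrable fun x => u x ^ 2) (hone : ∫ x, u x ^ 2 = 1)
    (hnear : IntegrableOn (fun p : EuclideanSpace ℝ (Fin N) × EuclideanSpace ℝ (Fin N) =>
      (u p.1 - u p.2) ^ 2 / dist p.1 p.2 ^ N) (near N)) :
    IntegrableOn (fun s => (Real.exp (-(1 / 4 / s)) - heatForm u s) / s) (Ioi 0) ∧
      ∫ s in Ioi 0, (Real.exp (-(1 / 4 / s)) - heatForm u s) / s = logForm u u := by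
  have hm := hu.aestronglyMeasurable
  have hmn : AEStronglyMeasurable (fun p : EuclideanSpace ℝ (Fin N) × EuclideanSpace ℝ (Fin N) =>
      (u p.1 - u p.2) ^ 2) (volume.restrict (near N)) :=
    ((hm.comp_fst.sub hm.comp_snd).pow 2).restrict
  have hmf : AEStronglyMeasurable (fun p : EuclideanSpace ℝ (Fin N) × EuclideanSpace ℝ (Fin N) =>
      u p.1 * u p.2) (volume.restrict (far N)) := (hm.comp_fst.mul hm.comp_snd).restrict
  have hdn : ∀ᵐ p ∂(volume.restrict (near N)), p.1 = p.2 → (u p.1 - u p.2) ^ 2 = 0 :=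
    Filter.Eventually.of_forall fun p hp => by simp [hp]
  have hdf : ∀ᵐ p ∂(volume.restrict (far N)), p.1 = p.2 → u p.1 * u p.2 = 0 := by
    filter_upwards [ae_restrict_mem measurableSet_far] with p hp h
    have : (1 : ℝ) ≤ dist p.1 p.2 := hp
    rw [h, dist_self] at this
    linarith
  have hff := integrableOn_far_mul hu
  have i1 := integrableOn_subordination hN hmn hdn hnear
  have i2 := integrableOn_subordination hN hmf hdf hff
  have e1 := integral_subordination hN hmn hdn hnear
  have e2 := integral_subordination hN hmf hdf hff
  have i3 := integrableOn_exp_sub_ballMass hN (c := 1 / 4) (by norm_num)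
  have e3 := integral_exp_sub_ballMass hN
  have key : ∀ s ∈ Ioi (0 : ℝ), (Real.exp (-(1 / 4 / s)) - heatForm u s) / s =
      (1 / 2) * ((∫ p in near N, (u p.1 - u p.2) ^ 2 * gaussKernel s (p.1 - p.2)) / s) -
      (∫ p in far N, u p.1 * u p.2 * gaussKernel s (p.1 - p.2)) / s +
      (Real.exp (-(1 / 4 / s)) - ballMass N s) / s := by
    intro s hs
    have h := near_far_heat_identity hN hu hu2 hs
    rw [hone, mul_one] at h
    rw [← mul_div_assoc, ← sub_div, h, ← add_div]
    ring
  refine ⟨IntegrableOn.congr_fun (((i1.const_mul (1 / 2)).sub i2).add i3)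
    (fun s hs => (key s hs).symm) measurableSet_Ioi, ?_⟩
  have e := integral_add ((i1.const_mul (1 / 2)).sub i2) i3
  simp only [Pi.sub_apply] at e
  rw [setIntegral_congr_fun measurableSet_Ioi key, e, integral_sub (i1.const_mul (1 / 2)) i2,
    integral_const_mul, e1, e2, e3, logForm, energy]
  simp_rw [← pow_two, hone]
  ring

end Space

/-! ### The heat form on the Fourier side and the bathtub estimate -/

section Fourier

variable {N : ℕ} {u : EuclideanSpace ℝ (Fin N) → ℝ} {s : ℝ}

/-- The Fourier integral, with the phase `⟪ξ, x⟫`. -/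
noncomputable def fourierInt (u : EuclideanSpace ℝ (Fin N) → ℝ) (ξ : EuclideanSpace ℝ (Fin N)) :
    ℂ :=
  ∫ x, (u x : ℂ) * Complex.exp (⟪ξ, x⟫ * Complex.I)

/-- The spectral density `(2π)^{-N} |∫ u(x) e^{i ξ·x} dx|²`. -/
noncomputable def specDensity (u : EuclideanSpace ℝ (Fin N) → ℝ)
    (ξ : EuclideanSpace ℝ (Fin N)) : ℝ :=
  ((2 * Real.pi) ^ N)⁻¹ * ‖fourierInt u ξ‖ ^ 2

lemma specDensity_nonneg (ξ : EuclideanSpace ℝ (Fin N)) : 0 ≤ specDensity u ξ := by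
  unfold specDensity; positivity

lemma continuous_fourierInt (hu : Integrable u) : Continuous (fourierInt u) := by
  unfold fourierInt
  refine continuous_of_dominated (bound := fun x => ‖u x‖) (fun ξ => ?_) (fun ξ => ?_) hu.norm ?_
  · exact hu.ofReal.aestronglyMeasurable.mul
      (by fun_prop : Continuous _).aestronglyMeasurable
  · refine Filter.Eventually.of_forall fun x => ?_
    rw [norm_mul, Complex.norm_exp_ofReal_mul_I, mul_one, Complex.norm_real]
  · exact Filter.Eventually.of_forall fun x => by fun_prop

lemma continuous_specDensity (hu : Integrable u) : Continuous (specDensity u) :=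
  continuous_const.mul ((continuous_fourierInt hu).norm.pow 2)

lemma norm_fourierInt_le (ξ : EuclideanSpace ℝ (Fin N)) : ‖fourierInt u ξ‖ ≤ ∫ x, |u x| := by
  refine (norm_integral_le_integral_norm _).trans_eq ?_
  congr 1
  ext x
  rw [norm_mul, Complex.norm_exp_ofReal_mul_I, mul_one, Complex.norm_real, Real.norm_eq_abs]

lemma specDensity_le (ξ : EuclideanSpace ℝ (Fin N)) :
    specDensity u ξ ≤ ((2 * Real.pi) ^ N)⁻¹ * (∫ x, |u x|) ^ 2 := by
  unfold specDensity
  gcongr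
  exact norm_fourierInt_le ξ

lemma norm_fourierInt_sq (ξ : EuclideanSpace ℝ (Fin N)) :
    ((‖fourierInt u ξ‖ ^ 2 : ℝ) : ℂ) =
      ∫ p : EuclideanSpace ℝ (Fin N) × EuclideanSpace ℝ (Fin N),
        ((u p.1 * u p.2 : ℝ) : ℂ) * Complex.exp (⟪ξ, p.1 - p.2⟫ * Complex.I) := by
  have h : (starRingEnd ℂ) (fourierInt u ξ) =
      ∫ x, (u x : ℂ) * Complex.exp (-(⟪ξ, x⟫ * Complex.I)) := by
    rw [fourierInt, ← integral_conj]
    congr 1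
    ext x
    rw [map_mul, ← Complex.exp_conj, map_mul, Complex.conj_I, Complex.conj_ofReal,
      Complex.conj_ofReal, mul_neg]
  push_cast
  rw [← Complex.mul_conj', h, fourierInt, ← integral_prod_mul]
  rw [Measure.volume_eq_prod]
  congr 1
  ext p
  rw [inner_sub_right]
  push_cast
  rw [sub_mul, sub_eq_add_neg, Complex.exp_add]
  ring

lemma gaussKernel_eq_integral (hs : 0 < s) (z : EuclideanSpace ℝ (Fin N)) :
    ((gaussKernel s z : ℝ) : ℂ) = ((2 * Real.pi : ℂ) ^ N)⁻¹ *
      ∫ ξ : EuclideanSpace ℝ (Fin N),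
        ((Real.exp (-(‖ξ‖ ^ 2 / 4 / s)) : ℝ) : ℂ) * Complex.exp (⟪ξ, z⟫ * Complex.I) := by
  have hb : 0 < ((1 / (4 * s) : ℝ) : ℂ).re := by
    rw [Complex.ofReal_re]; positivity
  have h := GaussianFourier.integral_cexp_neg_mul_sq_norm_add hb Complex.I z
  have h1 : ∀ ξ : EuclideanSpace ℝ (Fin N),
      ((Real.exp (-(‖ξ‖ ^ 2 / 4 / s)) : ℝ) : ℂ) * Complex.exp (⟪ξ, z⟫ * Complex.I) =
      Complex.exp (-((1 / (4 * s) : ℝ) : ℂ) * (‖ξ‖ : ℂ) ^ 2 + Complex.I * (⟪z, ξ⟫ : ℝ)) := by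
    intro ξ
    rw [Complex.exp_add, real_inner_comm, mul_comm Complex.I, Complex.ofReal_exp]
    congr 2
    push_cast
    field_simp
  simp_rw [h1]
  rw [h, finrank_euclideanSpace_fin]
  have h2 : ((Real.pi : ℂ) / ((1 / (4 * s) : ℝ) : ℂ)) ^ ((N : ℂ) / 2) =
      (((4 * Real.pi * s) ^ ((N : ℝ) / 2) : ℝ) : ℂ) := by
    rw [Complex.ofReal_cpow (by positivity)]
    push_cast
    congr 1
    field_simp
  have h3 : Complex.exp (Complex.I ^ 2 * (‖z‖ : ℂ) ^ 2 / (4 * ((1 / (4 * s) : ℝ) : ℂ))) =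
      ((Real.exp (-s * ‖z‖ ^ 2) : ℝ) : ℂ) := by
    rw [Complex.ofReal_exp, Complex.I_sq]
    congr 1
    have : (s : ℂ) ≠ 0 := by exact_mod_cast hs.ne'
    push_cast
    field_simp
  rw [h2, h3, gaussKernel]
  norm_cast
  rw [← mul_assoc]
  congr 1
  -- Writing $(2\pi)^N=(4\pi^2)^{N/2}$ puts all constants under one real power.
  have h4 : (2 * Real.pi) ^ N = (4 * Real.pi * Real.pi) ^ ((N : ℝ) / 2) := by
    rw [show 4 * Real.pi * Real.pi = (2 * Real.pi) ^ (2 : ℝ) by rw [Real.rpow_two]; ring,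
      ← Real.rpow_mul (by positivity), ← Real.rpow_natCast]
    congr 1
    ring
  rw [h4, ← Real.inv_rpow (by positivity), ← Real.mul_rpow (by positivity) (by positivity)]
  congr 1
  field_simp

lemma integrable_exp_neg_norm_sq_div (hs : 0 < s) :
    Integrable fun ξ : EuclideanSpace ℝ (Fin N) => Real.exp (-(‖ξ‖ ^ 2 / 4 / s)) := by
  have h := integrable_gaussKernel (N := N) (s := 1 / (4 * s)) (by positivity)
  unfold gaussKernel at h
  rw [integrable_const_mul_iff (IsUnit.mk0 _ (by positivity))] at h
  refine h.congr (Filter.Eventually.of_forall fun ξ => ?_)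
  simp only
  congr 1
  field_simp

lemma integrable_exp_mul_specDensity (hu : Integrable u) (hs : 0 < s) :
    Integrable fun ξ => Real.exp (-(‖ξ‖ ^ 2 / 4 / s)) * specDensity u ξ := by
  refine (integrable_exp_neg_norm_sq_div hs).mul_bdd
    (c := ((2 * Real.pi) ^ N)⁻¹ * (∫ x, |u x|) ^ 2)
    (continuous_specDensity hu).aestronglyMeasurable (Filter.Eventually.of_forall fun ξ => ?_)
  rw [Real.norm_of_nonneg (specDensity_nonneg ξ)]
  exact specDensity_le ξ

/-- The quadratic form of the heat semigroup on the Fourier side. -/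
lemma heatForm_eq_integral_specDensity (hu : Integrable u) (hs : 0 < s) :
    heatForm u s = ∫ ξ, Real.exp (-(‖ξ‖ ^ 2 / 4 / s)) * specDensity u ξ := by
  have hint : Integrable (fun q : EuclideanSpace ℝ (Fin N) ×
      (EuclideanSpace ℝ (Fin N) × EuclideanSpace ℝ (Fin N)) =>
      (((Real.exp (-(‖q.1‖ ^ 2 / 4 / s)) : ℝ) : ℂ) * ((u q.2.1 * u q.2.2 : ℝ) : ℂ)) *
        Complex.exp (⟪q.1, q.2.1 - q.2.2⟫ * Complex.I)) (volume.prod volume) := by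
    refine Integrable.mul_bdd (c := 1)
      ((integrable_exp_neg_norm_sq_div hs).ofReal.mul_prod (hu.mul_prod hu).ofReal)
      (by fun_prop : Continuous _).aestronglyMeasurable (Filter.Eventually.of_forall fun q => ?_)
    rw [Complex.norm_exp_ofReal_mul_I]
  have h1 : ∀ ξ : EuclideanSpace ℝ (Fin N),
      ((Real.exp (-(‖ξ‖ ^ 2 / 4 / s)) * specDensity u ξ : ℝ) : ℂ) =
      ((2 * Real.pi : ℂ) ^ N)⁻¹ *
        ∫ p : EuclideanSpace ℝ (Fin N) × EuclideanSpace ℝ (Fin N),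
          (((Real.exp (-(‖ξ‖ ^ 2 / 4 / s)) : ℝ) : ℂ) * ((u p.1 * u p.2 : ℝ) : ℂ)) *
            Complex.exp (⟪ξ, p.1 - p.2⟫ * Complex.I) := by
    intro ξ
    simp_rw [mul_assoc _ ((u _ * u _ : ℝ) : ℂ)]
    rw [integral_const_mul, ← norm_fourierInt_sq, specDensity]
    push_cast
    ring
  have h2 : ∀ p : EuclideanSpace ℝ (Fin N) × EuclideanSpace ℝ (Fin N),
      ((u p.1 * u p.2 * gaussKernel s (p.1 - p.2) : ℝ) : ℂ) =
      ((2 * Real.pi : ℂ) ^ N)⁻¹ * ∫ ξ : EuclideanSpace ℝ (Fin N),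
          (((Real.exp (-(‖ξ‖ ^ 2 / 4 / s)) : ℝ) : ℂ) * ((u p.1 * u p.2 : ℝ) : ℂ)) *
            Complex.exp (⟪ξ, p.1 - p.2⟫ * Complex.I) := by
    intro p
    simp_rw [mul_comm _ ((u _ * u _ : ℝ) : ℂ), mul_assoc ((u _ * u _ : ℝ) : ℂ)]
    rw [integral_const_mul, Complex.ofReal_mul, gaussKernel_eq_integral hs]
    ring
  rw [← Complex.ofReal_inj, heatForm, ← integral_complex_ofReal, ← integral_complex_ofReal]
  simp_rw [h1, h2]
  rw [integral_const_mul, integral_const_mul, ← integral_integral_swap (f := fun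
    (ξ : EuclideanSpace ℝ (Fin N)) (p : EuclideanSpace ℝ (Fin N) × EuclideanSpace ℝ (Fin N)) =>
    (((Real.exp (-(‖ξ‖ ^ 2 / 4 / s)) : ℝ) : ℂ) * ((u p.1 * u p.2 : ℝ) : ℂ)) *
      Complex.exp (⟪ξ, p.1 - p.2⟫ * Complex.I)) hint]

/-- Half of Plancherel, by Fatou: the weights tend to $1$ as $s\to\infty$, while every heat form is
at most $\|u\|_2^2$. Only this inequality is needed later. -/
lemma lintegral_specDensity_le (hu : Integrable u) (hu2 : Integrable fun x => u x ^ 2) :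
    ∫⁻ ξ, ENNReal.ofReal (specDensity u ξ) ≤ ENNReal.ofReal (∫ x, u x ^ 2) := by
  have hlim : ∀ ξ, Filter.liminf (fun n : ℕ => ENNReal.ofReal
      (Real.exp (-(‖ξ‖ ^ 2 / 4 / ((n : ℝ) + 1))) * specDensity u ξ)) Filter.atTop =
      ENNReal.ofReal (specDensity u ξ) := by
    intro ξ
    refine Filter.Tendsto.liminf_eq (ENNReal.tendsto_ofReal ?_)
    have h : Filter.Tendsto (fun n : ℕ => ‖ξ‖ ^ 2 / 4 / ((n : ℝ) + 1)) Filter.atTop (nhds 0) :=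
      Filter.Tendsto.const_div_atTop
        (Filter.tendsto_atTop_add_const_right _ _ tendsto_natCast_atTop_atTop) _
    have h2 := (Real.continuous_exp.tendsto _).comp h.neg
    rw [neg_zero, Real.exp_zero] at h2
    simpa using h2.mul_const (specDensity u ξ)
  simp_rw [← hlim]
  have hcont := continuous_specDensity hu
  refine (lintegral_liminf_le fun n => ?_).trans ?_
  · fun_prop
  · refine Filter.liminf_le_of_frequently_le' (Filter.Frequently.of_forall fun n => ?_)
    have hn : (0 : ℝ) < (n : ℝ) + 1 := by positivity
    rw [← ofReal_integral_eq_lintegral_ofReal (integrable_exp_mul_specDensity hu hn)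
      (Filter.Eventually.of_forall fun ξ =>
        mul_nonneg (Real.exp_pos _).le (specDensity_nonneg ξ)),
      ← heatForm_eq_integral_specDensity hu hn]
    exact ENNReal.ofReal_le_ofReal (heatForm_le hu hu2 hn)

lemma integrable_specDensity (hu : Integrable u) (hu2 : Integrable fun x => u x ^ 2) :
    Integrable (specDensity u) := by
  refine ⟨(continuous_specDensity hu).aestronglyMeasurable, ?_⟩
  rw [hasFiniteIntegral_iff_ofReal (Filter.Eventually.of_forall specDensity_nonneg)]
  exact (lintegral_specDensity_le hu hu2).trans_lt ENNReal.ofReal_lt_top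

lemma integral_specDensity_le (hu : Integrable u) (hu2 : Integrable fun x => u x ^ 2) :
    ∫ ξ, specDensity u ξ ≤ ∫ x, u x ^ 2 := by
  rw [integral_eq_lintegral_of_nonneg_ae (Filter.Eventually.of_forall specDensity_nonneg)
    (continuous_specDensity hu).aestronglyMeasurable]
  exact ENNReal.toReal_le_of_le_ofReal (integral_nonneg fun x => sq_nonneg _)
    (lintegral_specDensity_le hu hu2)

lemma heatForm_le_bathtub (hu : Integrable u) (hu2 : Integrable fun x => u x ^ 2)
    (hone : ∫ x, u x ^ 2 = 1) {M τ : ℝ} (hτ : 0 ≤ τ)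
    (hM : ∀ ξ, specDensity u ξ ≤ M) (hs : 0 < s) :
    heatForm u s ≤ Real.exp (-(τ ^ 2 / 4 / s)) +
      M * ∫ ξ in Metric.ball (0 : EuclideanSpace ℝ (Fin N)) τ,
        (Real.exp (-(‖ξ‖ ^ 2 / 4 / s)) - Real.exp (-(τ ^ 2 / 4 / s))) := by
  set e := Real.exp (-(τ ^ 2 / 4 / s)) with he
  have hballi : IntegrableOn (fun ξ : EuclideanSpace ℝ (Fin N) =>
      Real.exp (-(‖ξ‖ ^ 2 / 4 / s)) - e) (Metric.ball 0 τ) :=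
    (integrable_exp_neg_norm_sq_div hs).integrableOn.sub
      (integrableOn_const (measure_ball_lt_top.ne))
  have hindi := (hballi.integrable_indicator measurableSet_ball).const_mul M
  have hsi := (integrable_specDensity hu hu2).const_mul e
  rw [heatForm_eq_integral_specDensity hu hs, ← integral_indicator measurableSet_ball,
    ← integral_const_mul]
  -- Pointwise, weight times density is at most $e$ times density plus $M$ times the excess of the
  -- weight over $e$ in the ball. Inside, the excess is nonnegative and the density is at most $M$;
  -- outside, the weight is at most $e$.
  refine (integral_mono (integrable_exp_mul_specDensity hu hs) (hsi.add hindi) fun ξ => ?_).trans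
    ((integral_add hsi hindi).trans_le ?_)
  · simp only [Pi.add_apply, indicator, Metric.mem_ball, dist_zero_right]
    split_ifs with h
    · have h1 : e ≤ Real.exp (-(‖ξ‖ ^ 2 / 4 / s)) := by
        rw [he]; gcongr
      nlinarith [mul_le_mul_of_nonneg_right (hM ξ) (sub_nonneg.2 h1)]
    · have h1 : Real.exp (-(‖ξ‖ ^ 2 / 4 / s)) ≤ e := by
        rw [he]; push Not at h; gcongr
      nlinarith [mul_le_mul_of_nonneg_right h1 (specDensity_nonneg (u := u) ξ)]
  · rw [integral_const_mul]
    gcongr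
    refine mul_le_of_le_one_right (Real.exp_pos _).le ?_
    rw [← hone]
    exact integral_specDensity_le hu hu2

end Fourier

/-- Cauchy–Schwarz on $\Omega$, from $\int_\Omega(|u|-m)^2\ge0$. -/
lemma sq_integral_abs_le {N : ℕ} {u : EuclideanSpace ℝ (Fin N) → ℝ}
    {Ω : Set (EuclideanSpace ℝ (Fin N))} (hfin : volume Ω ≠ ⊤)
    (hzero : ∀ x ∉ Ω, u x = 0) (hu : Integrable u) (hu2 : Integrable fun x => u x ^ 2) :
    (∫ x, |u x|) ^ 2 ≤ volume.real Ω * ∫ x, u x ^ 2 := by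
  have hpos : 0 ≤ volume.real Ω := measureReal_nonneg
  have h1 : ∫ x in Ω, |u x| = ∫ x, |u x| :=
    setIntegral_eq_integral_of_forall_compl_eq_zero fun x hx => by rw [hzero x hx, abs_zero]
  have h2 : ∫ x in Ω, u x ^ 2 = ∫ x, u x ^ 2 :=
    setIntegral_eq_integral_of_forall_compl_eq_zero fun x hx => by rw [hzero x hx]; simp
  have key : ∀ m : ℝ, 0 ≤ (∫ x, u x ^ 2) - 2 * m * (∫ x, |u x|) + m ^ 2 * volume.real Ω := by
    intro m
    have h0 : 0 ≤ ∫ x in Ω, (|u x| - m) ^ 2 := integral_nonneg fun x => sq_nonneg _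
    have hexp : ∀ x, (|u x| - m) ^ 2 = (u x ^ 2 - 2 * m * |u x|) + m ^ 2 := fun x => by
      rw [sub_sq, sq_abs]; ring
    have ha := hu.abs.integrableOn (s := Ω) |>.const_mul (2 * m)
    have e := integral_sub hu2.integrableOn ha
    have e' := integral_add (g := fun _ => m ^ 2) (Integrable.sub hu2.integrableOn ha)
      (integrableOn_const hfin (by simp))
    simp only [Pi.sub_apply] at e'
    simp_rw [hexp] at h0
    rw [e', e, integral_const_mul, h1, h2, setIntegral_const, smul_eq_mul] at h0
    linarith
  rcases hpos.eq_or_lt with h | h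
  · have hz : volume Ω = 0 := by
      simpa [Measure.real, ENNReal.toReal_eq_zero_iff, hfin] using h.symm
    rw [← h1, Measure.restrict_eq_zero.2 hz]
    simp [← h]
  -- The mean of $|u|$ over $\Omega$ is the minimizing $m$.
  · have := key ((∫ x, |u x|) / volume.real Ω)
    have e : (∫ x, u x ^ 2) - 2 * ((∫ x, |u x|) / volume.real Ω) * (∫ x, |u x|) +
        ((∫ x, |u x|) / volume.real Ω) ^ 2 * volume.real Ω =
        (volume.real Ω * (∫ x, u x ^ 2) - (∫ x, |u x|) ^ 2) / volume.real Ω := by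
      field_simp
      ring
    rw [e, le_div_iff₀ h, zero_mul] at this
    linarith

/-! ### The logarithm integrated over a ball -/

section LogBall

variable {N : ℕ} {τ : ℝ}

lemma hasDerivAt_pow_mul_log (hN : 1 ≤ N) {r : ℝ} (hr : 0 < r) :
    HasDerivAt (fun r : ℝ => r ^ N * (Real.log τ - Real.log r) / N + r ^ N / (N : ℝ) ^ 2)
      (r ^ (N - 1) * (Real.log τ - Real.log r)) r := by
  have hN0 : (N : ℝ) ≠ 0 := by positivity
  have h1 := hasDerivAt_pow N r
  have h2 := (Real.hasDerivAt_log hr.ne').const_sub (Real.log τ)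
  have h3 := ((h1.mul h2).div_const (N : ℝ)).add (h1.div_const ((N : ℝ) ^ 2))
  refine h3.congr_deriv ?_
  have hp : r ^ N = r ^ (N - 1) * r := by rw [← pow_succ, Nat.sub_add_cancel hN]
  rw [hp]
  field_simp
  ring

/-- One factor $r$ absorbs the logarithm, so the primitive is continuous at $0$ and the fundamental
theorem reaches that endpoint. -/
lemma continuous_pow_mul_log (hN : 1 ≤ N) :
    Continuous fun r : ℝ => r ^ N * (Real.log τ - Real.log r) / N + r ^ N / (N : ℝ) ^ 2 := by
  have h : (fun r : ℝ => r ^ N * (Real.log τ - Real.log r) / N + r ^ N / (N : ℝ) ^ 2) =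
      fun r : ℝ => (r ^ N * Real.log τ - r ^ (N - 1) * (r * Real.log r)) / N +
        r ^ N / (N : ℝ) ^ 2 := by
    ext r
    have hp : r ^ N = r ^ (N - 1) * r := by rw [← pow_succ, Nat.sub_add_cancel hN]
    rw [hp]
    ring
  rw [h]
  have := Real.continuous_mul_log
  fun_prop

lemma intervalIntegrable_pow_mul_log (hN : 1 ≤ N) (hτ : 0 < τ) :
    IntervalIntegrable (fun r => r ^ (N - 1) * (Real.log τ - Real.log r)) volume 0 τ := by
  rw [intervalIntegrable_iff_integrableOn_Ioc_of_le hτ.le]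
  refine intervalIntegral.integrableOn_deriv_of_nonneg (continuous_pow_mul_log hN).continuousOn
    (fun r hr => hasDerivAt_pow_mul_log hN hr.1) fun r hr => ?_
  exact mul_nonneg (pow_nonneg hr.1.le _) (sub_nonneg.2 (Real.log_le_log hr.1 hr.2.le))

lemma integral_pow_mul_log (hN : 1 ≤ N) (hτ : 0 < τ) :
    ∫ r in (0)..τ, r ^ (N - 1) * (Real.log τ - Real.log r) = τ ^ N / (N : ℝ) ^ 2 := by
  rw [intervalIntegral.integral_eq_sub_of_hasDerivAt_of_le hτ.le
    (continuous_pow_mul_log hN).continuousOn (fun r hr => hasDerivAt_pow_mul_log hN hr.1)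
    (intervalIntegrable_pow_mul_log hN hτ)]
  simp [zero_pow (Nat.one_le_iff_ne_zero.1 hN)]

lemma pow_smul_indicator_log (hτ : 0 < τ) {r : ℝ} (hr : r ∈ Ioi (0 : ℝ)) :
    r ^ (N - 1) • (Iio τ).indicator (fun r => Real.log (τ ^ 2 / 4 / (r ^ 2 / 4))) r =
      (Iio τ).indicator (fun r => 2 * (r ^ (N - 1) * (Real.log τ - Real.log r))) r := by
  have hr' : 0 < r := hr
  have h : Real.log (τ ^ 2 / 4 / (r ^ 2 / 4)) = 2 * (Real.log τ - Real.log r) := by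
    rw [div_div_div_cancel_right₀ (by norm_num), ← div_pow, Real.log_pow,
      Real.log_div hτ.ne' hr'.ne']
    norm_num
  simp only [indicator]
  split_ifs
  · rw [h, smul_eq_mul]; ring
  · simp

lemma ball_indicator_eq (f : ℝ → ℝ) :
    (Metric.ball (0 : EuclideanSpace ℝ (Fin N)) τ).indicator (fun ξ => f ‖ξ‖) =
      fun ξ => (Iio τ).indicator f ‖ξ‖ := by
  ext ξ
  simp [indicator]

lemma integrableOn_log_ball (hN : 1 ≤ N) (hτ : 0 < τ) :
    IntegrableOn (fun ξ : EuclideanSpace ℝ (Fin N) => Real.log (τ ^ 2 / 4 / (‖ξ‖ ^ 2 / 4)))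
      (Metric.ball 0 τ) := by
  have := nontrivial_of_one_le hN
  rw [← integrable_indicator_iff measurableSet_ball,
    ball_indicator_eq fun r => Real.log (τ ^ 2 / 4 / (r ^ 2 / 4)), integrable_fun_norm_addHaar,
    finrank_euclideanSpace_fin,
    integrableOn_congr_fun (fun r hr => pow_smul_indicator_log hτ hr) measurableSet_Ioi]
  have h := (intervalIntegrable_iff_integrableOn_Ioc_of_le hτ.le).1
    (intervalIntegrable_pow_mul_log hN hτ)
  rw [IntegrableOn, integrable_indicator_iff measurableSet_Iio, IntegrableOn,
    Measure.restrict_restrict measurableSet_Iio]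
  refine Integrable.const_mul (IntegrableOn.mono_set h fun x hx => ?_) 2
  exact ⟨hx.2, le_of_lt hx.1⟩

lemma integral_log_ball (hN : 1 ≤ N) (hτ : 0 < τ) :
    ∫ ξ in Metric.ball (0 : EuclideanSpace ℝ (Fin N)) τ, Real.log (τ ^ 2 / 4 / (‖ξ‖ ^ 2 / 4)) =
      2 * sphereArea N * τ ^ N / (N : ℝ) ^ 2 := by
  have := nontrivial_of_one_le hN
  rw [← integral_indicator measurableSet_ball,
    ball_indicator_eq fun r => Real.log (τ ^ 2 / 4 / (r ^ 2 / 4)), integral_fun_norm_addHaar,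
    finrank_euclideanSpace_fin,
    setIntegral_congr_fun measurableSet_Ioi (fun r hr => pow_smul_indicator_log hτ hr),
    setIntegral_indicator measurableSet_Iio, Ioi_inter_Iio, ← integral_Ioc_eq_integral_Ioo,
    ← intervalIntegral.integral_of_le hτ.le, intervalIntegral.integral_const_mul,
    integral_pow_mul_log hN hτ, sphereArea, Measure.toSphere_real_apply_univ,
    finrank_euclideanSpace_fin]
  simp only [nsmul_eq_mul, smul_eq_mul]
  ring

lemma integrable_ball_exp_sub_exp (hN : 1 ≤ N) (hτ : 0 < τ) :
    Integrable (fun q : EuclideanSpace ℝ (Fin N) × ℝ =>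
      (Real.exp (-(‖q.1‖ ^ 2 / 4 / q.2)) - Real.exp (-(τ ^ 2 / 4 / q.2))) / q.2)
      ((volume.restrict (Metric.ball 0 τ)).prod (volume.restrict (Ioi 0))) := by
  have := nontrivial_of_one_le hN
  have hτ4 : 0 < τ ^ 2 / 4 := by positivity
  have hne : ∀ᵐ ξ ∂(volume.restrict (Metric.ball (0 : EuclideanSpace ℝ (Fin N)) τ)),
      0 < ‖ξ‖ ^ 2 / 4 ∧ ξ ∈ Metric.ball (0 : EuclideanSpace ℝ (Fin N)) τ := by
    filter_upwards [ae_restrict_mem measurableSet_ball,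
      ae_restrict_of_ae (Measure.ae_ne volume 0)] with ξ h1 h2
    have := norm_pos_iff.2 h2
    exact ⟨by positivity, h1⟩
  refine (integrable_prod_iff
    (by fun_prop : Measurable _).aestronglyMeasurable).2 ⟨?_, ?_⟩
  · filter_upwards [hne] with ξ hξ using integrableOn_exp_sub_exp hξ.1 hτ4
  · refine Integrable.congr (integrableOn_log_ball hN hτ) ?_
    filter_upwards [hne] with ξ hξ
    rw [← integral_exp_sub_exp hξ.1 hτ4]
    refine setIntegral_congr_fun measurableSet_Ioi fun s hs => (Real.norm_of_nonneg ?_).symm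
    have hs' : 0 < s := hs
    have hξτ : ‖ξ‖ < τ := by simpa using hξ.2
    refine div_nonneg (sub_nonneg.2 ?_) hs'.le
    gcongr

lemma integrableOn_ball_exp_sub_exp (hN : 1 ≤ N) (hτ : 0 < τ) :
    IntegrableOn (fun s => (∫ ξ in Metric.ball (0 : EuclideanSpace ℝ (Fin N)) τ,
      (Real.exp (-(‖ξ‖ ^ 2 / 4 / s)) - Real.exp (-(τ ^ 2 / 4 / s)))) / s) (Ioi 0) := by
  have h := (integrable_ball_exp_sub_exp hN hτ).integral_prod_right
  simp only [integral_div] at h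
  exact h

/-- After Fubini, Frullani's formula at fixed $\xi$ leaves $2\log(\tau/|\xi|)$ to integrate over the
ball. -/
lemma integral_ball_exp_sub_exp (hN : 1 ≤ N) (hτ : 0 < τ) :
    ∫ s in Ioi 0, (∫ ξ in Metric.ball (0 : EuclideanSpace ℝ (Fin N)) τ,
      (Real.exp (-(‖ξ‖ ^ 2 / 4 / s)) - Real.exp (-(τ ^ 2 / 4 / s)))) / s =
      2 * sphereArea N * τ ^ N / (N : ℝ) ^ 2 := by
  have := nontrivial_of_one_le hN
  rw [← integral_log_ball hN hτ]
  simp_rw [← integral_div]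
  rw [← integral_integral_swap (integrable_ball_exp_sub_exp hN hτ)]
  refine integral_congr_ae ?_
  filter_upwards [ae_restrict_of_ae (Measure.ae_ne volume 0)] with ξ h2
  have := norm_pos_iff.2 h2
  exact integral_exp_sub_exp (by positivity) (by positivity)

end LogBall

/-! ### Integrability in the form domain and the lower bound for the form -/

section LowerBound

variable {N : ℕ} {Ω : Set (EuclideanSpace ℝ (Fin N))} {u : EuclideanSpace ℝ (Fin N) → ℝ}

/-- Square integrability is not part of the definition of `FormDomain`. For a.e. $x$ the slice of
the energy is finite and its weight is at least $1$ off the diagonal, so $u^2$ is integrable on the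
unit ball around $x$. Such $x$ are dense, and $\overline\Omega$ is compact. -/
lemma integrable_sq_of_mem_formDomain (hΩ : Bornology.IsBounded Ω) (hu : u ∈ FormDomain Ω) :
    Integrable fun x => u x ^ 2 := by
  obtain ⟨hm, hzero, hnear⟩ := hu
  have hae : ∀ᵐ x, IntegrableOn (fun y => u y ^ 2) (Metric.closedBall x 1) := by
    have h1 := (integrable_indicator_iff measurableSet_near).2 hnear
    rw [Measure.volume_eq_prod] at h1
    filter_upwards [h1.prod_right_ae] with x hx
    have h2 : IntegrableOn (fun y => (u x - u y) ^ 2) (Metric.closedBall x 1) := by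
      refine Integrable.mono' hx.integrableOn
        ((aemeasurable_const.sub hm).pow_const 2).aestronglyMeasurable.restrict ?_
      filter_upwards [ae_restrict_mem measurableSet_closedBall] with y hy
      rw [Metric.mem_closedBall, dist_comm] at hy
      rw [indicator_of_mem (show (x, y) ∈ near N from hy),
        Real.norm_of_nonneg (sq_nonneg _)]
      rcases eq_or_ne x y with rfl | hxy
      · simp
      · have hd : 0 < dist x y := dist_pos.2 hxy
        exact le_div_self (sq_nonneg _) (pow_pos hd N) (pow_le_one₀ hd.le hy)
    have h3 : IntegrableOn (fun _ : EuclideanSpace ℝ (Fin N) => 2 * u x ^ 2)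
        (Metric.closedBall x 1) :=
      integrableOn_const measure_closedBall_lt_top.ne enorm_ne_top
    refine Integrable.mono' ((h2.const_mul 2).add h3)
      (hm.pow_const 2).aestronglyMeasurable.restrict (Filter.Eventually.of_forall fun y => ?_)
    rw [Real.norm_of_nonneg (sq_nonneg _)]
    simp only [Pi.add_apply]
    -- $2(a-b)^2+2a^2-b^2=(2a-b)^2$.
    nlinarith [sq_nonneg (2 * u x - u y)]
  have hloc : LocallyIntegrable fun x => u x ^ 2 := by
    intro z
    obtain ⟨x, hx, hxz⟩ := (Measure.dense_of_ae hae).exists_dist_lt z one_pos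
    exact ⟨_, Metric.closedBall_mem_nhds_of_mem hxz, hx⟩
  have hcl := hloc.integrableOn_isCompact hΩ.isCompact_closure
  refine (integrableOn_iff_integrable_of_support_subset fun x hx => ?_).1 hcl
  by_contra h
  exact hx (by simp [hzero x fun h' => h (subset_closure h')])

lemma integrable_of_mem_formDomain (hΩ : Bornology.IsBounded Ω) (hΩm : MeasurableSet Ω)
    (hu : u ∈ FormDomain Ω) : Integrable u := by
  have h2 := integrable_sq_of_mem_formDomain hΩ hu
  have h1 : Integrable (Ω.indicator fun _ => (1 : ℝ)) :=
    (integrable_indicator_iff hΩm).2 (integrableOn_const hΩ.measure_lt_top.ne)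
  refine (h1.add h2).mono' hu.1.aestronglyMeasurable (Filter.Eventually.of_forall fun x => ?_)
  simp only [Pi.add_apply, indicator, Real.norm_eq_abs]
  split_ifs with h
  · nlinarith [sq_nonneg (|u x| - 1), sq_abs (u x), abs_nonneg (u x)]
  · simp [hu.2.1 x h]

lemma setIntegral_eq_of_mem_formDomain (hu : u ∈ FormDomain Ω) :
    ∫ x in Ω, u x ^ 2 = ∫ x, u x ^ 2 :=
  setIntegral_eq_integral_of_forall_compl_eq_zero fun x hx => by simp [hu.2.1 x hx]

/-- The bathtub estimate integrated against $ds/s$, with $M=(2\pi)^{-N}|\Omega|$ bounding the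
spectral density. -/
lemma le_logForm (hN : 1 ≤ N) (hΩ : Bornology.IsBounded Ω) (hΩm : MeasurableSet Ω)
    (hu : u ∈ FormDomain Ω) (hone : ∫ x in Ω, u x ^ 2 = 1) {τ : ℝ} (hτ : 0 < τ) :
    2 * Real.log τ - dN N * volume.real Ω * τ ^ N ≤ logForm u u := by
  rw [setIntegral_eq_of_mem_formDomain hu] at hone
  have hi := integrable_of_mem_formDomain hΩ hΩm hu
  have hi2 := integrable_sq_of_mem_formDomain hΩ hu
  obtain ⟨hint, heq⟩ := logForm_heat_representation hN hi hi2 hone hu.2.2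
  have hM : ∀ ξ, specDensity u ξ ≤ ((2 * Real.pi) ^ N)⁻¹ * volume.real Ω := by
    intro ξ
    refine (specDensity_le ξ).trans ?_
    gcongr
    have := sq_integral_abs_le hΩ.measure_lt_top.ne hu.2.1 hi hi2
    rwa [hone, mul_one] at this
  set M := ((2 * Real.pi) ^ N)⁻¹ * volume.real Ω with hMdef
  have h4 : (0 : ℝ) < 1 / 4 := by norm_num
  have hτ4 : 0 < τ ^ 2 / 4 := by positivity
  have j1 := integrableOn_exp_sub_exp h4 hτ4
  have j2 := (integrableOn_ball_exp_sub_exp hN hτ).const_mul M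
  have hlow : ∫ s in Ioi 0, ((Real.exp (-(1 / 4 / s)) - Real.exp (-(τ ^ 2 / 4 / s))) / s -
      M * ((∫ ξ in Metric.ball (0 : EuclideanSpace ℝ (Fin N)) τ,
        (Real.exp (-(‖ξ‖ ^ 2 / 4 / s)) - Real.exp (-(τ ^ 2 / 4 / s)))) / s)) =
      2 * Real.log τ - dN N * volume.real Ω * τ ^ N := by
    rw [integral_sub j1 j2, integral_const_mul, integral_exp_sub_exp h4 hτ4,
      integral_ball_exp_sub_exp hN hτ, div_div_div_cancel_right₀ (by norm_num), div_one,
      Real.log_pow, hMdef, dN]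
    push_cast
    field_simp
  rw [← hlow, ← heq]
  refine setIntegral_mono_on (j1.sub j2) hint measurableSet_Ioi fun s hs => ?_
  have hs' : 0 < s := hs
  have h := heatForm_le_bathtub hi hi2 hone hτ.le hM hs'
  rw [← mul_div_assoc, ← sub_div]
  refine div_le_div_of_nonneg_right ?_ hs'.le
  linarith

end LowerBound

/-! ### Scaling of Rayleigh values -/

variable {N : ℕ} {Ω : Set (EuclideanSpace ℝ (Fin N))} {u : EuclideanSpace ℝ (Fin N) → ℝ}

lemma const_mul_mem_formDomain (c : ℝ) (hu : u ∈ FormDomain Ω) :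
    (fun x => c * u x) ∈ FormDomain Ω := by
  refine ⟨hu.1.const_mul c, fun x hx => by simp [hu.2.1 x hx], ?_⟩
  refine (hu.2.2.const_mul (c ^ 2)).congr (Filter.Eventually.of_forall fun p => ?_)
  simp only
  ring

lemma logForm_const_mul (c : ℝ) :
    logForm (fun x => c * u x) (fun x => c * u x) = c ^ 2 * logForm u u := by
  have h1 : ∀ p : EuclideanSpace ℝ (Fin N) × EuclideanSpace ℝ (Fin N),
      (c * u p.1 - c * u p.2) * (c * u p.1 - c * u p.2) / dist p.1 p.2 ^ N =
        c ^ 2 * ((u p.1 - u p.2) * (u p.1 - u p.2) / dist p.1 p.2 ^ N) := fun p => by ring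
  have h2 : ∀ p : EuclideanSpace ℝ (Fin N) × EuclideanSpace ℝ (Fin N),
      c * u p.1 * (c * u p.2) / dist p.1 p.2 ^ N =
        c ^ 2 * (u p.1 * u p.2 / dist p.1 p.2 ^ N) := fun p => by ring
  have h3 : ∀ x, c * u x * (c * u x) = c ^ 2 * (u x * u x) := fun x => by ring
  simp only [logForm, energy, h1, h2, h3, integral_const_mul]
  ring

lemma div_mem_rayleighValues (hu : u ∈ FormDomain Ω) (hpos : 0 < ∫ x in Ω, u x ^ 2) :
    logForm u u / (∫ x in Ω, u x ^ 2) ∈ rayleighValues Ω := by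
  set I := ∫ x in Ω, u x ^ 2 with hI
  have hc : ((√I)⁻¹) ^ 2 = I⁻¹ := by rw [inv_pow, Real.sq_sqrt hpos.le]
  refine ⟨_, const_mul_mem_formDomain (√I)⁻¹ hu, ?_, ?_⟩
  · simp_rw [mul_pow]
    rw [integral_const_mul, hc, ← hI, inv_mul_cancel₀ hpos.ne']
  · rw [logForm_const_mul, hc, div_eq_inv_mul]

/-! ### The cone as a competitor -/

lemma integrable_ball_pow_div (hN : 1 ≤ N) :
    Integrable ((Metric.ball (0 : EuclideanSpace ℝ (Fin N)) 2).indicator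
      fun z => ‖z‖ ^ 2 / ‖z‖ ^ N) := by
  have := nontrivial_of_one_le hN
  rw [integrable_indicator_iff measurableSet_ball,
    integrableOn_fun_norm_addHaar volume (f := fun r => r ^ 2 / r ^ N), finrank_euclideanSpace_fin]
  have h : IntegrableOn (fun r : ℝ => r) (Ioo 0 2) :=
    (continuous_id.continuousOn.integrableOn_Icc (a := (0 : ℝ)) (b := 2)).mono_set
      Ioo_subset_Icc_self
  refine h.congr_fun (fun r hr => ?_) measurableSet_Ioo
  have hr0 : r ≠ 0 := hr.1.ne'
  have hp : r ^ N = r ^ (N - 1) * r := by rw [← pow_succ, Nat.sub_add_cancel hN]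
  simp only [smul_eq_mul]
  rw [hp]
  field_simp

/-- The cone function of radius `r` around `x₀`. -/
noncomputable def cone (x₀ : EuclideanSpace ℝ (Fin N)) (r : ℝ) (x : EuclideanSpace ℝ (Fin N)) :
    ℝ :=
  max 0 (r - dist x x₀)

variable {x₀ : EuclideanSpace ℝ (Fin N)} {r : ℝ}

lemma cone_eq_zero {x : EuclideanSpace ℝ (Fin N)} (hx : x ∉ Metric.ball x₀ r) :
    cone x₀ r x = 0 := by
  rw [Metric.mem_ball, not_lt] at hx
  exact max_eq_left (by linarith)

lemma continuous_cone : Continuous (cone x₀ r) := by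
  unfold cone; fun_prop

lemma abs_cone_sub_le (x y : EuclideanSpace ℝ (Fin N)) :
    |cone x₀ r x - cone x₀ r y| ≤ dist x y := by
  refine (abs_max_sub_max_le_max _ _ _ _).trans ?_
  rw [sub_self, abs_zero, max_le_iff]
  refine ⟨dist_nonneg, ?_⟩
  rw [sub_sub_sub_cancel_left, abs_sub_comm]
  exact abs_dist_sub_le x y x₀

lemma cone_mem_formDomain (hN : 1 ≤ N) (hball : Metric.ball x₀ r ⊆ Ω) :
    cone x₀ r ∈ FormDomain Ω := by
  refine ⟨continuous_cone.aemeasurable, fun x hx => cone_eq_zero fun h => hx (hball h), ?_⟩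
  set k := (Metric.ball (0 : EuclideanSpace ℝ (Fin N)) 2).indicator
    fun z => ‖z‖ ^ 2 / ‖z‖ ^ N with hk
  have heven : ∀ z, k (-z) = k z := fun z => by simp [hk, indicator]
  have hφ : Integrable ((Metric.ball x₀ (r + 1)).indicator fun _ => (1 : ℝ)) :=
    (integrable_indicator_iff measurableSet_ball).2
      (integrableOn_const measure_ball_lt_top.ne enorm_ne_top)
  have h := integrable_fst_mul_sub hφ (integrable_ball_pow_div hN) heven
  have hc := continuous_cone (x₀ := x₀) (r := r)
  refine h.integrableOn.mono' ?_ ?_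
  · refine (Measurable.div ?_ (measurable_dist.pow_const N)).aestronglyMeasurable
    exact (by fun_prop : Continuous _).measurable
  · filter_upwards [ae_restrict_mem measurableSet_near] with p hp
    have hp' : dist p.1 p.2 ≤ 1 := hp
    rw [Real.norm_of_nonneg (by positivity)]
    -- If the first point is outside the ball of radius $r+1$, the second is outside that of radius
    -- $r$, and both values vanish. Otherwise the Lipschitz bound gives the majorant $|z|^2/|z|^N$.
    by_cases hx : p.1 ∈ Metric.ball x₀ (r + 1)
    · have hz : p.1 - p.2 ∈ Metric.ball (0 : EuclideanSpace ℝ (Fin N)) 2 := by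
        rw [mem_ball_zero_iff, ← dist_eq_norm]
        linarith
      rw [indicator_of_mem hx, one_mul, indicator_of_mem hz, ← dist_eq_norm]
      have := sq_le_sq' (abs_le.1 (abs_cone_sub_le (x₀ := x₀) (r := r) p.1 p.2)).1
        (abs_le.1 (abs_cone_sub_le (x₀ := x₀) (r := r) p.1 p.2)).2
      gcongr
    · have h1 : p.1 ∉ Metric.ball x₀ r := fun h => hx (Metric.ball_subset_ball (by linarith) h)
      have h2 : p.2 ∉ Metric.ball x₀ r := by
        rw [Metric.mem_ball, not_lt] at hx ⊢
        linarith [dist_triangle p.1 p.2 x₀]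
      rw [cone_eq_zero h1, cone_eq_zero h2, indicator_of_notMem hx]
      simp

lemma rayleighValues_nonempty (hN : 1 ≤ N) (hΩ_open : IsOpen Ω) (hne : Ω.Nonempty)
    (hΩ : Bornology.IsBounded Ω) : (rayleighValues Ω).Nonempty := by
  obtain ⟨x₀, hx₀⟩ := hne
  obtain ⟨r, hr, hball⟩ := Metric.isOpen_iff.1 hΩ_open x₀ hx₀
  have hmem := cone_mem_formDomain hN hball
  refine ⟨_, div_mem_rayleighValues hmem ?_⟩
  rw [setIntegral_eq_of_mem_formDomain hmem]
  have hc := continuous_cone (x₀ := x₀) (r := r)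
  refine integral_pos_of_integrable_nonneg_nonzero (x := x₀) (by fun_prop)
    (integrable_sq_of_mem_formDomain hΩ hmem) (fun x => sq_nonneg _) ?_
  simp [cone, hr.ne', hr.le]

/-! ### Bounds for the principal eigenvalue -/

lemma le_of_mem_rayleighValues (hN : 1 ≤ N) (hΩ : Bornology.IsBounded Ω) (hΩm : MeasurableSet Ω)
    {τ : ℝ} (hτ : 0 < τ) {a : ℝ} (ha : a ∈ rayleighValues Ω) :
    2 * Real.log τ - dN N * volume.real Ω * τ ^ N ≤ a := by
  obtain ⟨u, hu, hone, rfl⟩ := ha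
  exact le_logForm hN hΩ hΩm hu hone hτ

lemma bddBelow_rayleighValues (hN : 1 ≤ N) (hΩ : Bornology.IsBounded Ω)
    (hΩm : MeasurableSet Ω) : BddBelow (rayleighValues Ω) :=
  ⟨_, fun _ ha => le_of_mem_rayleighValues hN hΩ hΩm one_pos ha⟩

lemma mem_rayleighValues_of_isEigenvalue (hΩ : Bornology.IsBounded Ω) {lam : ℝ}
    (h : IsEigenvalue Ω lam) : lam ∈ rayleighValues Ω := by
  obtain ⟨u, hu, hne, heq⟩ := h
  have hi := integrable_sq_of_mem_formDomain hΩ hu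
  have hpos : 0 < ∫ x in Ω, u x ^ 2 := by
    rw [setIntegral_eq_of_mem_formDomain hu]
    refine (integral_nonneg fun x => sq_nonneg _).lt_of_ne' fun h0 => hne ?_
    rw [integral_eq_zero_iff_of_nonneg (fun x => sq_nonneg _) hi] at h0
    filter_upwards [h0] with x hx
    simpa using hx
  have := div_mem_rayleighValues hu hpos
  -- The eigenfunction is its own test function.
  rw [heq u hu] at this
  simp_rw [← pow_two] at this
  rwa [mul_div_cancel_right₀ _ hpos.ne'] at this

lemma le_principalEigenvalue (hN : 1 ≤ N) (hΩ_open : IsOpen Ω) (hne : Ω.Nonempty)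
    (hΩ : Bornology.IsBounded Ω) {τ : ℝ} (hτ : 0 < τ) :
    2 * Real.log τ - dN N * volume.real Ω * τ ^ N ≤ principalEigenvalue Ω :=
  le_csInf (rayleighValues_nonempty hN hΩ_open hne hΩ)
    fun _ ha => le_of_mem_rayleighValues hN hΩ hΩ_open.measurableSet hτ ha

lemma dN_pos (hN : 1 ≤ N) : 0 < dN N := by
  have := nontrivial_of_one_le hN
  have h : 0 < sphereArea N := by
    rw [sphereArea, Measure.toSphere_real_apply_univ, finrank_euclideanSpace_fin]
    have : 0 < volume.real (Metric.ball (0 : EuclideanSpace ℝ (Fin N)) 1) :=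
      ENNReal.toReal_pos (Metric.measure_ball_pos _ _ one_pos).ne' measure_ball_lt_top.ne
    positivity
  unfold dN
  positivity

/-- The lower bound with the optimal radius. -/
lemma log_le_principalEigenvalue (hN : 1 ≤ N) (hΩ_open : IsOpen Ω) (hne : Ω.Nonempty)
    (hΩ : Bornology.IsBounded Ω) :
    2 / N * Real.log (2 / (Real.exp 1 * N * dN N * volume.real Ω)) ≤ principalEigenvalue Ω := by
  have hd := dN_pos hN
  have hV : 0 < volume.real Ω :=
    ENNReal.toReal_pos (hΩ_open.measure_pos volume hne).ne' hΩ.measure_lt_top.ne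
  have hN0 : (0 : ℝ) < N := by positivity
  set X := 2 / (N * dN N * volume.real Ω) with hX
  have hXpos : 0 < X := by positivity
  -- $\tau=X^{1/N}$ is the critical point of $2\log\tau-d_N|\Omega|\tau^N$.
  have h := le_principalEigenvalue hN hΩ_open hne hΩ (Real.rpow_pos_of_pos hXpos (1 / (N : ℝ)))
  rw [Real.log_rpow hXpos, ← Real.rpow_natCast, ← Real.rpow_mul hXpos.le,
    one_div_mul_cancel hN0.ne', Real.rpow_one] at h
  have e : 2 / (Real.exp 1 * N * dN N * volume.real Ω) = X / Real.exp 1 := by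
    rw [hX]; field_simp
  have e2 : dN N * volume.real Ω * X = 2 / N := by
    rw [hX]; field_simp
  rw [e, Real.log_div hXpos.ne' (Real.exp_pos 1).ne', Real.log_exp]
  rw [e2] at h
  calc _ = 2 * (1 / (N : ℝ) * Real.log X) - 2 / N := by ring
    _ ≤ _ := h

end LogLaplacian

open MeasureTheory LogLaplacian

theorem mainTheorem4 (N : ℕ) (hN : 1 ≤ N) (Ω : Set (EuclideanSpace ℝ (Fin N)))
    (hΩ_open : IsOpen Ω) (hΩ_conn : IsConnected Ω) (hΩ_bdd : Bornology.IsBounded Ω) :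
    -- the infimum defining the principal eigenvalue is a genuine one
    IsGLB (LogLaplacian.rayleighValues Ω) (LogLaplacian.principalEigenvalue Ω) ∧
    -- no eigenvalue of the Dirichlet problem is smaller
    (∀ lam : ℝ, LogLaplacian.IsEigenvalue Ω lam →
      LogLaplacian.principalEigenvalue Ω ≤ lam) ∧
    LogLaplacian.principalEigenvalue Ω ≥ -(LogLaplacian.dN N * MeasureTheory.volume.real Ω) ∧
    (MeasureTheory.volume.real Ω < 2 / (Real.exp 1 * N * LogLaplacian.dN N) →
      0 < LogLaplacian.principalEigenvalue Ω) ∧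
    (MeasureTheory.volume.real Ω ≤ 2 / (Real.exp (Real.exp 1 + 1) * N * LogLaplacian.dN N) →
      LogLaplacian.principalEigenvalue Ω ≥
        2 / N * (Real.log (2 / (Real.exp 1 * N * LogLaplacian.dN N * MeasureTheory.volume.real Ω))
          - Real.log (Real.log
              (2 / (Real.exp 1 * N * LogLaplacian.dN N * MeasureTheory.volume.real Ω))))) := by
  have hne := hΩ_conn.nonempty
  have hbdd := bddBelow_rayleighValues hN hΩ_bdd hΩ_open.measurableSet
  have hlog := log_le_principalEigenvalue hN hΩ_open hne hΩ_bdd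
  have hd := dN_pos hN
  have hV : 0 < volume.real Ω :=
    ENNReal.toReal_pos (hΩ_open.measure_pos volume hne).ne' hΩ_bdd.measure_lt_top.ne
  have hN0 : (0 : ℝ) < N := by positivity
  refine ⟨isGLB_csInf (rayleighValues_nonempty hN hΩ_open hne hΩ_bdd) hbdd,
    fun lam h => csInf_le hbdd (mem_rayleighValues_of_isEigenvalue hΩ_bdd h), ?_, fun h => ?_,
    fun h => ?_⟩
  · simpa using le_principalEigenvalue hN hΩ_open hne hΩ_bdd one_pos
  · refine lt_of_lt_of_le (mul_pos (by positivity) (Real.log_pos ?_)) hlog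
    rw [lt_div_iff₀ (by positivity)] at h ⊢
    linarith
  -- The argument of the logarithm is at least $e^e$, so its logarithm is at least $e$ and the
  -- subtracted term is nonnegative: (iii) is weaker than `hlog`.
  · have hX : Real.exp (Real.exp 1) ≤ 2 / (Real.exp 1 * N * dN N * volume.real Ω) := by
      rw [le_div_iff₀ (by positivity), Real.exp_add] at h
      rw [le_div_iff₀ (by positivity)]
      linarith
    have h1 := (Real.le_log_iff_exp_le ((Real.exp_pos _).trans_le hX)).2 hX
    have h2 := Real.log_nonneg ((Real.one_le_exp zero_le_one).trans h1)
    refine le_trans (mul_le_mul_of_nonneg_left ?_ (by positivity)) hlog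
    linarith
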